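/- Let $N\ge 2$ be an integer and $1/2<s<1$. Put $2^*_s=\frac{2N}{N-2s}$ and let $c_{N,s}=\frac{s4^s\Gamma(N/2+s)}{\pi^{N/2}\Gamma(1-s)}$ be the usual normalization constant of $(-\Delta)^s$. For an open set $\Omega\subset\mathbb R^N$ let $$Q_{N,s,\Omega}(u)=\frac{c_{N,s}}2\int_\Omega\int_\Omega\frac{(u(x)-u(y))^2}{|x-y|^{N+2s}}\,dx\,dy ,\qquad \|u\|_{H^s(\Omega)}^2=\|u\|_{L^2(\Omega)}^2+Q_{N,s,\Omega}(u),$$ let $H^s(\Omega)$ be the space of measurable $u:\Omega\to\mathbb R$ (modulo equality almost everywhere) with $\|u\|_{H^s(\Omega)}<\infty$, let $H^s_0(\Omega)$ be the closure of $C_c^\infty(\Omega)$ in $H^s(\Omega)$, and let $$S_{N,s}(\mathbb R^N)=\inf_{u\in H^s_0(\mathbb R^N),\,u\ne0}\frac{Q_{N,s,\mathbb R^N}(u)}{\|u\|^2_{L^{2^*_s}(\mathbb R^N)}} .$$ Let $\mathcal B$ be the open unit ball of $\mathbb R^N$ centered at the origin and let $H^s_{0,rad}(\mathcal B)$ be the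 space of those $u\in H^s_0(\mathcal B)$ that are radially symmetric, i.e. $u(x)=f(|x|)$ for almost every $x\in\mathcal B$, for some function $f$. Then there is a constant $C=C(N,s)>0$ such that for all $u\in H^s_{0,rad}(\mathcal B)$ $$Q_{N,s,\mathcal B}(u)\ \ge\ S_{N,s}(\mathbb R^N)\,\|u\|^2_{L^{2^*_s}(\mathcal B)}-C\,\|u\|^2_{L^2(\mathcal B)} .$$ -/

import Mathlib

open MeasureTheory
open scoped ENNReal

/-- The usual normalization constant of the fractional Laplacian `(-Δ)^s` on `ℝ^N`,
`c_{N,s} = s 4^s Γ(N/2 + s) / (π^{N/2} Γ(1 - s))`. -/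
noncomputable def fracLapConst (N : ℕ) (s : ℝ) : ℝ :=
  s * (4 : ℝ) ^ s * Real.Gamma ((N : ℝ) / 2 + s) /
    (Real.pi ^ ((N : ℝ) / 2) * Real.Gamma (1 - s))

/-- The quadratic form `Q_{N,s,Ω}(u) = (c_{N,s}/2) ∫_Ω ∫_Ω (u x - u y)² / |x - y|^{N+2s} dx dy`,
with values in `[0, ∞]`. -/
noncomputable def regionalForm (N : ℕ) (s : ℝ) (Ω : Set (EuclideanSpace ℝ (Fin N)))
    (u : EuclideanSpace ℝ (Fin N) → ℝ) : ℝ≥0∞ :=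
  ENNReal.ofReal (fracLapConst N s / 2) *
    ∫⁻ x in Ω, ∫⁻ y in Ω, ENNReal.ofReal ((u x - u y) ^ 2 / ‖x - y‖ ^ ((N : ℝ) + 2 * s))

/-- The `L^p(Ω)` norm with values in `[0, ∞]`. -/
noncomputable def normLp (N : ℕ) (p : ℝ) (Ω : Set (EuclideanSpace ℝ (Fin N)))
    (u : EuclideanSpace ℝ (Fin N) → ℝ) : ℝ≥0∞ :=
  eLpNorm u (ENNReal.ofReal p) (volume.restrict Ω)

/-- The squared norm of `H^s(Ω)`. -/
noncomputable def normSqHs (N : ℕ) (s : ℝ) (Ω : Set (EuclideanSpace ℝ (Fin N)))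
    (u : EuclideanSpace ℝ (Fin N) → ℝ) : ℝ≥0∞ :=
  normLp N 2 Ω u ^ 2 + regionalForm N s Ω u

/-- `u` is (a representative of an element) of the fractional Sobolev space `H^s(Ω)`. -/
def MemHs (N : ℕ) (s : ℝ) (Ω : Set (EuclideanSpace ℝ (Fin N)))
    (u : EuclideanSpace ℝ (Fin N) → ℝ) : Prop :=
  AEStronglyMeasurable u (volume.restrict Ω) ∧ normSqHs N s Ω u < (⊤ : ℝ≥0∞)

/-- `φ ∈ C_c^∞(Ω)`. -/
def IsTestFunction (N : ℕ) (Ω : Set (EuclideanSpace ℝ (Fin N)))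
    (φ : EuclideanSpace ℝ (Fin N) → ℝ) : Prop :=
  ContDiff ℝ ((⊤ : ℕ∞) : WithTop ℕ∞) φ ∧ HasCompactSupport φ ∧ tsupport φ ⊆ Ω

/-- `u ∈ H^s_0(Ω)`: the completion of `C_c^∞(Ω)` for the `H^s(Ω)` norm, realized as the closure
of `C_c^∞(Ω)` in the Hilbert space `H^s(Ω)`. -/
def MemHs0 (N : ℕ) (s : ℝ) (Ω : Set (EuclideanSpace ℝ (Fin N)))
    (u : EuclideanSpace ℝ (Fin N) → ℝ) : Prop :=
  MemHs N s Ω u ∧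
    ∀ ε : ℝ≥0∞, 0 < ε → ∃ φ, IsTestFunction N Ω φ ∧ normSqHs N s Ω (fun x => u x - φ x) < ε

/-- `u ∈ H^s_{0,rad}(Ω)`: the radially symmetric elements of `H^s_0(Ω)`. -/
def MemHs0Rad (N : ℕ) (s : ℝ) (Ω : Set (EuclideanSpace ℝ (Fin N)))
    (u : EuclideanSpace ℝ (Fin N) → ℝ) : Prop :=
  MemHs0 N s Ω u ∧ ∃ f : ℝ → ℝ, ∀ᵐ x ∂(volume.restrict Ω), u x = f ‖x‖

/-- The fractional critical Sobolev exponent `2^*_s = 2N / (N - 2s)`. -/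
noncomputable def critExp (N : ℕ) (s : ℝ) : ℝ := 2 * (N : ℝ) / ((N : ℝ) - 2 * s)

/-- The best Sobolev constant `S_{N,s}(Ω)`: the infimum of `Q_{N,s,Ω}(u) / ‖u‖²_{L^{2^*_s}(Ω)}`
over the nonzero `u ∈ H^s_0(Ω)`. -/
noncomputable def sobolevConst (N : ℕ) (s : ℝ) (Ω : Set (EuclideanSpace ℝ (Fin N))) : ℝ≥0∞ :=
  ⨅ (u : EuclideanSpace ℝ (Fin N) → ℝ) (_ : MemHs0 N s Ω u)
    (_ : ¬ ∀ᵐ x ∂(volume.restrict Ω), u x = 0),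
    regionalForm N s Ω u / normLp N (critExp N s) Ω u ^ 2

/-! The sharp constant belongs to the inequality on the whole space, so `u` is cut into a piece near
the origin, where that inequality applies with constant exactly `S`, and a radial piece away from
the origin, where the critical norm is a subcritical perturbation.

The cut is `v = cos θ · u`, `w = sin θ · u`, with `θ(|x|)` smooth, `0` for `|x| ≤ 1/2` and `π/2` for
`|x| ≥ 3/4`. Since `v² + w² = u²`, the triangle inequality in `L^{p/2}` with `p = 2^*_s ≥ 2` gives
`‖u‖_p² ≤ ‖v‖_p² + ‖w‖_p²` (`normLp_sq_le_cos_add_sin`). The forms recombine without losing a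
factor: the cross term is `2 u(x) u(y) (1 - cos(θ(x) - θ(y)))`, of order `|x - y|²`, and it leaves
the kernel `|x - y|^{2-N-2s}`, which is locally integrable because `s < 1`. Hence `Q(v) + Q(w) ≤
Q(u) + C‖u‖₂²` (`regionalForm_cos_add_sin_le`).

Extending `v` by zero costs only an `L²` term, because its support stays at distance `1/4` from the
complement of the ball (`regionalForm_univ_le`). The extension lies in `H^s_0(ℝ^N)`
(`memHs0_univ_cos_mul`), so the definition of `S` bounds it.

For `w`, polar coordinates reduce the form to the one-dimensional Gagliardo seminorm of the profile
on `(1/2, 1)` (`gagliardoSq_le_of_radial`). In dimension one `s > 1/2` is the Morrey range: a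
chaining argument bounds the profile pointwise by the seminorm and the `L²` norm
(`sq_le_gagliardoSq_add`). Working at a small scale `d` makes the seminorm's coefficient, of order
`d^{2s-1}`, as small as desired. Thus `‖w‖_p² ≤ ε Q(w) + C‖w‖₂²` for every `ε > 0`
(`normLp_sq_le_of_radial`), and a choice with `S ε ≤ 1` closes the argument. -/

/-! ### Polar coordinates and the measure of spherical caps. -/

section Polar

variable {E : Type*} [NormedAddCommGroup E] [NormedSpace ℝ E] [FiniteDimensional ℝ E]
  [MeasurableSpace E] [BorelSpace E] [Nontrivial E] (μ : Measure E) [μ.IsAddHaarMeasure]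

/-- Integration in polar coordinates for the Lebesgue integral. -/
theorem lintegral_eq_lintegral_sphere_Ioi {G : E → ℝ≥0∞} (hG : Measurable G) :
    ∫⁻ x, G x ∂μ = ∫⁻ ω, (∫⁻ r in Set.Ioi (0 : ℝ),
      ENNReal.ofReal (r ^ (Module.finrank ℝ E - 1)) * G (r • (ω : E))) ∂μ.toSphere := by
  have hcoe : Measurable (fun p : Metric.sphere (0 : E) 1 × Set.Ioi (0 : ℝ) =>
      (p.2 : ℝ) • (p.1 : E)) := by fun_prop
  calc
    ∫⁻ x, G x ∂μ = ∫⁻ x : ({(0)}ᶜ : Set E), G x.1 ∂(μ.comap (↑)) := by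
      rw [lintegral_subtype_comap (measurableSet_singleton _).compl, restrict_compl_singleton]
    _ = ∫⁻ p, G ((p.2 : ℝ) • (p.1 : E))
          ∂μ.toSphere.prod (.volumeIoiPow (Module.finrank ℝ E - 1)) := by
      refine Eq.trans ?_ (μ.measurePreserving_homeomorphUnitSphereProd.lintegral_comp
        (hG.comp hcoe))
      refine lintegral_congr fun x => ?_
      have hx : ‖(x : E)‖ ≠ 0 := norm_ne_zero_iff.mpr x.2
      simp [smul_smul, hx]
    _ = _ := by
      refine (lintegral_prod _ (hG.comp hcoe).aemeasurable).trans ?_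
      refine lintegral_congr fun ω => ?_
      have hm : Measurable (fun r : ℝ => G (r • (ω : E))) := hG.comp (by fun_prop)
      rw [Measure.volumeIoiPow, lintegral_withDensity_eq_lintegral_mul]
      · rw [← lintegral_subtype_comap measurableSet_Ioi]
        rfl
      · exact ((measurable_subtype_coe.pow_const _)).ennreal_ofReal
      · exact hm.comp measurable_subtype_coe

/-- A null set meets almost every sphere radius in a null set of directions. -/
theorem ae_polar_of_ae {p : E → Prop} (hp : ∀ᵐ x ∂μ, p x) :
    ∀ᵐ ω : Metric.sphere (0 : E) 1 ∂μ.toSphere, ∀ᵐ r ∂volume.restrict (Set.Ioi (0 : ℝ)), p (r • (ω : E)) := by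
  set T := toMeasurable μ {x | ¬ p x} with hT
  have hTm : MeasurableSet T := measurableSet_toMeasurable _ _
  have h0 : ∫⁻ x, T.indicator 1 x ∂μ = 0 := by
    rw [lintegral_indicator_one hTm, hT, measure_toMeasurable]; exact hp
  have hind : Measurable (T.indicator (1 : E → ℝ≥0∞)) := measurable_one.indicator hTm
  have hm : Measurable (fun q : Metric.sphere (0 : E) 1 × ℝ =>
      ENNReal.ofReal (q.2 ^ (Module.finrank ℝ E - 1)) * T.indicator 1 (q.2 • (q.1 : E))) := by
    refine Measurable.mul (by fun_prop) (hind.comp (by fun_prop))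
  rw [lintegral_eq_lintegral_sphere_Ioi μ hind, lintegral_eq_zero_iff hm.lintegral_prod_right'] at h0
  filter_upwards [h0] with ω hω
  have hω' := (lintegral_eq_zero_iff (hm.comp measurable_prodMk_left)).1 hω
  filter_upwards [hω', ae_restrict_mem measurableSet_Ioi] with r hr hr0
  by_contra hcon
  have hmem : r • (ω : E) ∈ T := subset_toMeasurable μ {x | ¬ p x} hcon
  have : 0 < r ^ (Module.finrank ℝ E - 1) := pow_pos hr0 _
  simp [Set.indicator_of_mem hmem] at hr
  linarith

/-- Lower bound of an integral over the unit ball by polar integration over a shell. -/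
theorem lintegral_sphere_Ioo_le {G : E → ℝ≥0∞} (hG : Measurable G) {a : ℝ} (ha : 0 < a) :
    ENNReal.ofReal (a ^ (Module.finrank ℝ E - 1)) *
      ∫⁻ ω, (∫⁻ r in Set.Ioo a 1, G (r • (ω : E))) ∂μ.toSphere
      ≤ ∫⁻ x in Metric.ball (0 : E) 1, G x ∂μ := by
  rw [← lintegral_indicator Metric.isOpen_ball.measurableSet,
    lintegral_eq_lintegral_sphere_Ioi μ (hG.indicator Metric.isOpen_ball.measurableSet),
    ← lintegral_const_mul']
  swap; · exact ENNReal.ofReal_ne_top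
  refine lintegral_mono fun ω => ?_
  rw [← lintegral_const_mul' _ _ ENNReal.ofReal_ne_top]
  refine le_trans ?_ (lintegral_mono_set (s := Set.Ioo a 1) fun r hr => ha.trans hr.1)
  refine setLIntegral_mono' measurableSet_Ioo fun r hr => ?_
  have hr0 : 0 < r := ha.trans hr.1
  have hmem : r • (ω : E) ∈ Metric.ball (0 : E) 1 := by
    simp [norm_smul, abs_of_pos hr0, hr.2]
  rw [Set.indicator_of_mem hmem]
  gcongr
  exact hr.1.le

/-- A ball of radius `δ/8` centred at depth `δ/2` below `e` fits in the cone over the cap, truncated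
to radii in `(1 - δ, 1)`. Polar integration bounds its volume, of order `δ^n`, by `δ` times the cap
measure; dividing by `δ` leaves `δ^(n-1)`. -/
theorem toSphere_cap_ge {δ : ℝ} (h0 : 0 < δ) (h1 : δ ≤ 1) (e : Metric.sphere (0 : E) 1) :
    ENNReal.ofReal (δ ^ (Module.finrank ℝ E - 1) / 8 ^ (Module.finrank ℝ E)) * μ (Metric.ball 0 1)
      ≤ μ.toSphere (Metric.closedBall e δ) := by
  have he : ‖(e : E)‖ = 1 := by simp
  set n := Module.finrank ℝ E with hn
  have hn0 : n - 1 + 1 = n := Nat.sub_add_cancel Module.finrank_pos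
  set c : E := (1 - δ / 2) • (e : E) with hc
  have hcn : ‖c‖ = 1 - δ / 2 := by
    rw [hc, norm_smul, he, mul_one, Real.norm_of_nonneg (by linarith)]
  have hball : MeasurableSet (Metric.ball c (δ / 8)) := Metric.isOpen_ball.measurableSet
  have hpt : ∀ (ω : Metric.sphere (0 : E) 1) (r : ℝ), 0 < r →
      r • (ω : E) ∈ Metric.ball c (δ / 8) → r ∈ Set.Ioo (1 - δ) 1 ∧ ω ∈ Metric.closedBall e δ := by
    intro ω r hr hmem
    have hω : ‖(ω : E)‖ = 1 := by simp
    rw [mem_ball_iff_norm] at hmem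
    have hrn : ‖r • (ω : E)‖ = r := by rw [norm_smul, hω, mul_one, Real.norm_of_nonneg hr.le]
    have h2 : |r - (1 - δ / 2)| < δ / 8 := by
      have := abs_norm_sub_norm_le (r • (ω : E)) c
      rw [hrn, hcn] at this
      exact this.trans_lt hmem
    obtain ⟨h3, h4⟩ := abs_lt.1 h2
    refine ⟨⟨by linarith, by linarith⟩, ?_⟩
    rw [Metric.mem_closedBall, Subtype.dist_eq, dist_eq_norm]
    have h5 : ‖r • ((ω : E) - e)‖ ≤ δ / 8 + δ / 8 := by
      have : r • ((ω : E) - e) = (r • (ω : E) - c) + ((1 - δ / 2) - r) • (e : E) := by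
        rw [hc]; module
      rw [this]
      refine (norm_add_le _ _).trans (add_le_add hmem.le ?_)
      rw [norm_smul, he, mul_one, Real.norm_eq_abs, abs_sub_comm]
      exact h2.le
    rw [norm_smul, Real.norm_of_nonneg hr.le] at h5
    -- `r > 1 - 5δ/8 ≥ 3/8`, so `r ‖ω - e‖ ≤ δ/4` forces `‖ω - e‖ ≤ 2δ/3`.
    have h6 : (3 : ℝ) / 8 ≤ r := by linarith
    nlinarith [norm_nonneg ((ω : E) - e)]
  have key : μ (Metric.ball c (δ / 8)) ≤ μ.toSphere (Metric.closedBall e δ) * ENNReal.ofReal δ := by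
    rw [← lintegral_indicator_one hball,
      lintegral_eq_lintegral_sphere_Ioi μ (measurable_one.indicator hball)]
    calc _ ≤ ∫⁻ ω, (Metric.closedBall e δ).indicator (fun _ => ENNReal.ofReal δ) ω ∂μ.toSphere := by
          refine lintegral_mono fun ω => ?_
          by_cases hω : ω ∈ Metric.closedBall e δ
          · rw [Set.indicator_of_mem hω]
            calc _ ≤ ∫⁻ r in Set.Ioi (0 : ℝ), (Set.Ioo (1 - δ) 1).indicator 1 r := by
                  refine setLIntegral_mono' measurableSet_Ioi fun r hr => ?_
                  by_cases hmem : r • (ω : E) ∈ Metric.ball c (δ / 8)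
                  · have hr1 := (hpt ω r hr hmem).1
                    rw [Set.indicator_of_mem hmem, Set.indicator_of_mem hr1]
                    simp only [Pi.one_apply, mul_one]
                    exact ENNReal.ofReal_le_one.2 (pow_le_one₀ (le_of_lt hr) hr1.2.le)
                  · rw [Set.indicator_of_notMem hmem]; simp
              _ ≤ ∫⁻ r, (Set.Ioo (1 - δ) 1).indicator 1 r := setLIntegral_le_lintegral _ _
              _ = ENNReal.ofReal δ := by
                  rw [lintegral_indicator_one measurableSet_Ioo, Real.volume_Ioo]; congr 1; ring
          · rw [Set.indicator_of_notMem hω, nonpos_iff_eq_zero,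
              setLIntegral_congr_fun (g := fun _ => 0) measurableSet_Ioi]
            · simp
            · intro r hr
              have : r • (ω : E) ∉ Metric.ball c (δ / 8) := fun h => hω (hpt ω r hr h).2
              simp [Set.indicator_of_notMem this]
      _ = _ := by
          rw [lintegral_indicator_const Metric.isClosed_closedBall.measurableSet, mul_comm]
  rw [Measure.addHaar_ball_of_pos _ _ (by positivity)] at key
  have hδ : ENNReal.ofReal δ ≠ 0 := by simpa using h0
  refine (ENNReal.mul_le_mul_iff_left hδ ENNReal.ofReal_ne_top).1 (le_trans (le_of_eq ?_) key)
  rw [mul_right_comm, ← ENNReal.ofReal_mul (by positivity)]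
  congr 2
  rw [div_pow, ← hn]
  nth_rw 3 [← hn0]
  rw [pow_succ]; ring

end Polar

/-! ### From the radial Gagliardo form to the one-dimensional seminorm. -/

section Seminorm

/-- Removing the singular weight on a region where the distance is at most `L`. -/
theorem ofReal_sq_le_mul_div_rpow {A t L p : ℝ} (hp : 0 < p) (ht : 0 ≤ t) (htL : t ≤ L)
    (hA : t = 0 → A = 0) :
    ENNReal.ofReal (A ^ 2) ≤ ENNReal.ofReal (L ^ p) * ENNReal.ofReal (A ^ 2 / t ^ p) := by
  rcases ht.eq_or_lt with h | h
  · simp [hA h.symm]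
  · rw [← ENNReal.ofReal_mul (Real.rpow_nonneg (ht.trans htL) _)]
    refine ENNReal.ofReal_le_ofReal ?_
    have h1 : 0 < t ^ p := Real.rpow_pos_of_pos h p
    have h2 : t ^ p ≤ L ^ p := Real.rpow_le_rpow ht htL hp.le
    rw [mul_div_assoc', le_div_iff₀ h1, mul_comm]
    exact mul_le_mul_of_nonneg_right h2 (sq_nonneg A)

/-- The one-dimensional Gagliardo seminorm of `f` on the set `S` (squared). -/
noncomputable def gagliardoSq (s : ℝ) (S : Set ℝ) (f : ℝ → ℝ) : ℝ≥0∞ :=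
  ∫⁻ r in S, ∫⁻ t in S, ENNReal.ofReal ((f r - f t) ^ 2 / |r - t| ^ (1 + 2 * s))

/-- The Gagliardo form of a radial function controls the one-dimensional seminorm of its
profile away from the origin. -/
theorem gagliardoSq_le_of_radial {N : ℕ} (hN : 2 ≤ N) {s a : ℝ} (hs : 0 < s) (ha : 0 < a) :
    ∃ c : ℝ, 0 < c ∧ ∀ f : ℝ → ℝ, Measurable f →
      ENNReal.ofReal c * gagliardoSq s (Set.Ioo a 1) f ≤
        ∫⁻ x in Metric.ball (0 : EuclideanSpace ℝ (Fin N)) 1,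
          ∫⁻ y in Metric.ball (0 : EuclideanSpace ℝ (Fin N)) 1,
            ENNReal.ofReal ((f ‖x‖ - f ‖y‖) ^ 2 / ‖x - y‖ ^ ((N : ℝ) + 2 * s)) := by
  have : Nonempty (Fin N) := ⟨⟨0, by omega⟩⟩
  have hfr : Module.finrank ℝ (EuclideanSpace ℝ (Fin N)) = N := by simp
  set E := EuclideanSpace ℝ (Fin N) with hE
  set V : ℝ := (volume (Metric.ball (0 : E) 1)).toReal with hV
  have hVt : volume (Metric.ball (0 : E) 1) ≠ ⊤ := measure_ball_lt_top.ne
  have hV0 : 0 < V := ENNReal.toReal_pos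
    (Metric.isOpen_ball.measure_pos _ ⟨0, by simp⟩).ne' hVt
  set p : ℝ := (N : ℝ) + 2 * s with hp
  have hp0 : 0 < p := by positivity
  set c₀ : ℝ := V / (8 ^ N * 2 ^ p) with hc₀
  have hc₀0 : 0 < c₀ := by positivity
  -- Each `a ^ (N - 1)` bounds the polar Jacobian below, once per variable; `N * V` is the area of
  -- the unit sphere; `c₀` collects the cap constant and the `2 ^ p` from `‖x - y‖ ≤ 2δ`.
  refine ⟨a ^ (N - 1) * ((N * V) * (a ^ (N - 1) * c₀)), by positivity, fun f hf => ?_⟩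
  obtain ⟨K, hKdef⟩ : ∃ K : E → E → ℝ≥0∞, K = fun x y =>
    ENNReal.ofReal ((f ‖x‖ - f ‖y‖) ^ 2 / ‖x - y‖ ^ p) := ⟨_, rfl⟩
  have hK : Measurable (Function.uncurry K) := by
    rw [hKdef]
    simp only [Function.uncurry_def]
    fun_prop
  set H : ℝ → ℝ≥0∞ := fun r => ∫⁻ t in Set.Ioo a 1,
    ENNReal.ofReal ((f r - f t) ^ 2 / |r - t| ^ (1 + 2 * s)) with hH
  have inner : ∀ (ω : Metric.sphere (0 : E) 1) (r : ℝ), r ∈ Set.Ioo a 1 →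
      ENNReal.ofReal (a ^ (N - 1) * c₀) * H r ≤
        ∫⁻ y in Metric.ball (0 : E) 1, K (r • (ω : E)) y := by
    intro ω r hr
    have hω : ‖(ω : E)‖ = 1 := by simp
    have hr0 : 0 < r := ha.trans hr.1
    have hrn : ‖r • (ω : E)‖ = r := by rw [norm_smul, hω, mul_one, Real.norm_of_nonneg hr0.le]
    have hKr : Measurable (K (r • (ω : E))) := hK.of_uncurry_left
    refine le_trans ?_ (lintegral_sphere_Ioo_le volume hKr ha)
    rw [hfr, ENNReal.ofReal_mul (by positivity), mul_assoc]
    gcongr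
    have hm : Measurable (fun q : Metric.sphere (0 : E) 1 × ℝ =>
        K (r • (ω : E)) (q.2 • (q.1 : E))) := hKr.comp (by fun_prop)
    rw [lintegral_lintegral_swap hm.aemeasurable, hH, ← lintegral_const_mul' _ _
      ENNReal.ofReal_ne_top]
    refine setLIntegral_mono' measurableSet_Ioo fun t ht => ?_
    have ht0 : 0 < t := ha.trans ht.1
    rcases eq_or_ne r t with rfl | hrt
    · simp only [sub_self, ne_eq, OfNat.ofNat_ne_zero, not_false_eq_true, zero_pow, zero_div,
        ENNReal.ofReal_zero, mul_zero, zero_le]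
    have hδ : 0 < |r - t| := abs_pos.2 (sub_ne_zero.2 hrt)
    have hδ1 : |r - t| ≤ 1 := by
      rw [abs_le]; constructor <;> linarith [hr.1, hr.2, ht.1, ht.2]
    set δ := |r - t| with hδdef
    -- Only directions `θ` within `δ = |r - t|` of `ω` are kept. There `‖rω - tθ‖ ≤ 2δ`, and the cap
    -- measure, of order `δ^(N-1)`, lowers the exponent from `N + 2s` to `1 + 2s`.
    calc ENNReal.ofReal c₀ * ENNReal.ofReal ((f r - f t) ^ 2 / δ ^ (1 + 2 * s))
        = ENNReal.ofReal ((f r - f t) ^ 2 / (2 * δ) ^ p) *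
          (ENNReal.ofReal (δ ^ (Module.finrank ℝ E - 1) / 8 ^ (Module.finrank ℝ E)) *
            volume (Metric.ball (0 : E) 1)) := by
          rw [← ENNReal.ofReal_toReal hVt, ← hV, ← ENNReal.ofReal_mul hc₀0.le,
            ← ENNReal.ofReal_mul (by positivity), ← ENNReal.ofReal_mul (by positivity), hfr]
          congr 1
          have e1 : δ ^ p = δ ^ (N - 1) * δ ^ (1 + 2 * s) := by
            rw [← Real.rpow_natCast δ (N - 1), ← Real.rpow_add hδ, hp]
            congr 1
            rw [Nat.cast_sub (by omega)]; push_cast; ring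
          rw [Real.mul_rpow (by norm_num) hδ.le, e1, hc₀]
          have := Real.rpow_pos_of_pos hδ (1 + 2 * s)
          have := pow_pos hδ (N - 1)
          field_simp
      _ ≤ ENNReal.ofReal ((f r - f t) ^ 2 / (2 * δ) ^ p) *
          volume.toSphere (Metric.closedBall ω δ) := by
          gcongr
          exact toSphere_cap_ge volume hδ hδ1 ω
      _ = ∫⁻ θ in Metric.closedBall ω δ, ENNReal.ofReal ((f r - f t) ^ 2 / (2 * δ) ^ p)
            ∂(volume : Measure E).toSphere := by rw [setLIntegral_const]
      _ ≤ ∫⁻ θ in Metric.closedBall ω δ, K (r • (ω : E)) (t • (θ : E))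
            ∂(volume : Measure E).toSphere := by
          refine setLIntegral_mono' Metric.isClosed_closedBall.measurableSet fun θ hθ => ?_
          have hθn : ‖(θ : E)‖ = 1 := by simp
          have htn : ‖t • (θ : E)‖ = t := by
            rw [norm_smul, hθn, mul_one, Real.norm_of_nonneg ht0.le]
          have hθd : ‖(ω : E) - θ‖ ≤ δ := by
            rw [Metric.mem_closedBall, dist_comm, Subtype.dist_eq, dist_eq_norm] at hθ
            exact hθ
          have hle : ‖r • (ω : E) - t • (θ : E)‖ ≤ 2 * δ := by
            have : r • (ω : E) - t • (θ : E) = (r - t) • (ω : E) + t • ((ω : E) - θ) := by module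
            rw [this]
            refine (norm_add_le _ _).trans ?_
            rw [norm_smul, norm_smul, hω, Real.norm_eq_abs, Real.norm_of_nonneg ht0.le]
            nlinarith [norm_nonneg ((ω : E) - θ), ht.2]
          have hpos : 0 < ‖r • (ω : E) - t • (θ : E)‖ := by
            refine lt_of_lt_of_le hδ ?_
            have := abs_norm_sub_norm_le (r • (ω : E)) (t • (θ : E))
            rwa [hrn, htn] at this
          simp only [hKdef, hrn, htn]
          refine ENNReal.ofReal_le_ofReal ?_
          gcongr
      _ ≤ _ := setLIntegral_le_lintegral _ _
  have houter : Measurable (fun x : E => ∫⁻ y in Metric.ball (0 : E) 1, K x y) :=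
    hK.lintegral_prod_right'
  have hgoal := lintegral_sphere_Ioo_le volume houter ha
  simp only [hKdef] at hgoal
  refine le_trans ?_ hgoal
  rw [hfr, ENNReal.ofReal_mul (by positivity), mul_assoc]
  gcongr
  calc ENNReal.ofReal (N * V * (a ^ (N - 1) * c₀)) * gagliardoSq s (Set.Ioo a 1) f
      = ∫⁻ _ω, (∫⁻ r in Set.Ioo a 1, ENNReal.ofReal (a ^ (N - 1) * c₀) * H r)
          ∂(volume : Measure E).toSphere := by
        rw [lintegral_const, lintegral_const_mul' _ _ ENNReal.ofReal_ne_top,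
          Measure.toSphere_apply_univ, hfr, ← ENNReal.ofReal_toReal hVt, ← hV,
          ENNReal.ofReal_mul (by positivity), ENNReal.ofReal_mul (p := (N : ℝ)) (by positivity),
          ENNReal.ofReal_natCast]
        simp only [gagliardoSq, hH]
        ring
    _ ≤ _ := lintegral_mono fun ω => setLIntegral_mono' measurableSet_Ioo fun r hr => by
        have := inner ω r hr
        simpa only [hKdef] using this

end Seminorm

/-! ### A pointwise fractional Morrey estimate on the line. -/

section Chaining

/-- Iterating the recursion `n` times leaves a remainder `l ^ n * D n ≤ G * (l * m) ^ n`, which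
tends to `0`. The a priori decay therefore enters only qualitatively: `G` is absent from the
conclusion. -/
theorem ENNReal.le_of_geometric_recursion {D : ℕ → ℝ≥0∞} {l A q G m : ℝ≥0∞} (hG : G ≠ ⊤)
    (hlm : l * m < 1) (h : ∀ k, D k ≤ l * D (k + 1) + A * q ^ k) (hD : ∀ k, D k ≤ G * m ^ k) :
    D 0 ≤ A * (1 - l * q)⁻¹ := by
  have h1 : ∀ n, D 0 ≤ l ^ n * D n + A * ∑ k ∈ Finset.range n, (l * q) ^ k := by
    intro n
    induction n with
    | zero => simp
    | succ n ih =>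
      refine ih.trans ?_
      grw [h n]
      rw [Finset.sum_range_succ]
      apply le_of_eq
      ring
  have h2 : ∀ n, D 0 ≤ G * (l * m) ^ n + A * (1 - l * q)⁻¹ := by
    intro n
    refine (h1 n).trans (add_le_add ?_ ?_)
    · grw [hD n]
      apply le_of_eq
      ring
    · rw [← ENNReal.tsum_geometric]
      gcongr
      exact ENNReal.sum_le_tsum _
  have h3 : Filter.Tendsto (fun n => G * (l * m) ^ n + A * (1 - l * q)⁻¹) Filter.atTop
      (nhds (G * 0 + A * (1 - l * q)⁻¹)) :=
    (ENNReal.Tendsto.const_mul (ENNReal.tendsto_pow_atTop_nhds_zero_of_lt_one hlm)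
      (Or.inr hG)).add tendsto_const_nhds
  simpa using ge_of_tendsto' h3 h2

/-- A pointwise fractional Morrey estimate by chaining along a family of sets shrinking to `r`. -/
theorem sq_le_gagliardoSq_add {s : ℝ} (hs : 1 / 2 < s) :
    ∃ K : ℝ, 0 < K ∧ ∀ (f : ℝ → ℝ), Measurable f → ∀ (S : Set ℝ) (I : ℝ → Set ℝ) (r d : ℝ),
      0 < d → (∀ l, MeasurableSet (I l)) →
      (∀ l, 0 < l → l ≤ d → volume (I l) = ENNReal.ofReal l ∧ I l ⊆ S ∧ ∀ y ∈ I l, |y - r| ≤ l) →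
      ∫⁻ y in S, ENNReal.ofReal ((f r - f y) ^ 2 / |r - y| ^ (1 + 2 * s)) ≠ ⊤ →
      ENNReal.ofReal d * ENNReal.ofReal (f r ^ 2) ≤
        ENNReal.ofReal (K * d ^ (2 * s)) * gagliardoSq s S f +
          2 * ∫⁻ y in S, ENNReal.ofReal (f y ^ 2) := by
  -- The weight in `(a + b)² ≤ lam a² + κ b²`. It must exceed `1`, yet each halving of the scale
  -- costs `2 * lam` and gains `q = 2^(-2s)`; this choice gives `2 * lam * q = 2^(1/2 - s) < 1`,
  -- exactly because `s > 1/2`.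
  set lam : ℝ := 2 ^ (s - 1 / 2) with hlam
  have hlam1 : 1 < lam := Real.one_lt_rpow (by norm_num) (by linarith)
  have hlam0 : 0 < lam := by linarith
  set κ : ℝ := 1 + 1 / (lam - 1) with hκ
  have hlam2 : 0 < lam - 1 := by linarith
  have hκ0 : 0 < κ := by positivity
  set p : ℝ := 1 + 2 * s with hp
  have hp0 : 0 < p := by linarith
  set q : ℝ := 2 ^ (-(2 * s)) with hq
  have hq0 : 0 < q := by positivity
  have hlq : 2 * lam * q < 1 := by
    have : 2 * lam * q = 2 ^ (1 / 2 - s) := by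
      rw [hlam, hq]
      nth_rw 1 [← Real.rpow_one 2]
      rw [← Real.rpow_add (by norm_num), ← Real.rpow_add (by norm_num)]
      congr 1; ring
    rw [this]
    exact Real.rpow_lt_one_of_one_lt_of_neg (by norm_num) (by linarith)
  set B : ℝ := 2 * κ * 2 ^ p with hB
  have hB0 : 0 < B := by positivity
  refine ⟨2 * (B * (1 - 2 * lam * q)⁻¹), ?_, ?_⟩
  · have : 0 < 1 - 2 * lam * q := by linarith
    positivity
  intro f hf S I r d hd hIm hI hg
  set J := gagliardoSq s S f with hJ
  obtain ⟨l, hl⟩ : ∃ l : ℕ → ℝ, l = fun k => d * (1 / 2) ^ k := ⟨_, rfl⟩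
  have hl0 : ∀ k, 0 < l k := fun k => by rw [hl]; positivity
  have hld : ∀ k, l k ≤ d := fun k => by
    have : ((1 : ℝ) / 2) ^ k ≤ 1 := pow_le_one₀ (by norm_num) (by norm_num)
    simp only [hl]; nlinarith
  have hls : ∀ k, l k = 2 * l (k + 1) := fun k => by simp only [hl, pow_succ]; ring
  set e : ℕ → ℝ≥0∞ := fun k => ∫⁻ y in I (l k), ENNReal.ofReal ((f r - f y) ^ 2) with he
  have hvol : ∀ k, volume (I (l k)) = ENNReal.ofReal (l k) := fun k => (hI _ (hl0 k) (hld k)).1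
  have hsub : ∀ k, I (l k) ⊆ S := fun k => (hI _ (hl0 k) (hld k)).2.1
  have hdist : ∀ k, ∀ y ∈ I (l k), |y - r| ≤ l k := fun k => (hI _ (hl0 k) (hld k)).2.2
  -- One link of the chain: `f r` is compared with `f y` through an intermediate `f z`, averaged
  -- over `z ∈ I (l (k + 1))`. The factor `2` is `l k / l (k + 1)`.
  have hrec : ∀ k, e k ≤ ENNReal.ofReal (2 * lam) * e (k + 1) +
      (ENNReal.ofReal (B * d ^ (2 * s)) * J) * ENNReal.ofReal q ^ k := by
    intro k
    have hne : ENNReal.ofReal (l (k + 1)) ≠ 0 := by simpa using hl0 (k + 1)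
    have hcross : ∫⁻ z in I (l (k + 1)), ∫⁻ y in I (l k), ENNReal.ofReal ((f z - f y) ^ 2) ≤
        ENNReal.ofReal ((2 * l k) ^ p) * J := by
      calc _ ≤ ∫⁻ z in I (l (k + 1)), ∫⁻ y in I (l k), ENNReal.ofReal ((2 * l k) ^ p) *
              ENNReal.ofReal ((f z - f y) ^ 2 / |z - y| ^ p) := by
            refine setLIntegral_mono' (hIm _) fun z hz => setLIntegral_mono' (hIm _) fun y hy => ?_
            refine ofReal_sq_le_mul_div_rpow hp0 (abs_nonneg _) ?_ ?_
            · have h1 := abs_le.1 (hdist _ z hz)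
              have h2 := abs_le.1 (hdist _ y hy)
              have h3 := hls k
              have h4 := hl0 (k + 1)
              rw [abs_le]; constructor <;> linarith [h1.1, h1.2, h2.1, h2.2]
            · intro h
              rw [sub_eq_zero.1 (abs_eq_zero.1 h), sub_self]
        _ = ENNReal.ofReal ((2 * l k) ^ p) * ∫⁻ z in I (l (k + 1)), ∫⁻ y in I (l k),
              ENNReal.ofReal ((f z - f y) ^ 2 / |z - y| ^ p) := by
            simp_rw [lintegral_const_mul' _ _ ENNReal.ofReal_ne_top]
        _ ≤ _ := by
            rw [hJ, gagliardoSq]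
            refine mul_le_mul_right ?_ _
            refine (lintegral_mono_set (hsub (k + 1))).trans (lintegral_mono fun z => ?_)
            exact lintegral_mono_set (hsub k)
    have hmain : ENNReal.ofReal (l (k + 1)) * e k ≤ ENNReal.ofReal (l (k + 1)) *
        (ENNReal.ofReal (2 * lam) * e (k + 1) +
          (ENNReal.ofReal (B * d ^ (2 * s)) * J) * ENNReal.ofReal q ^ k) := by
      calc ENNReal.ofReal (l (k + 1)) * e k
          = ∫⁻ _z in I (l (k + 1)), e k := by rw [setLIntegral_const, hvol, mul_comm]
        _ ≤ ∫⁻ z in I (l (k + 1)), (ENNReal.ofReal (l k) * (ENNReal.ofReal lam *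
              ENNReal.ofReal ((f r - f z) ^ 2)) + ENNReal.ofReal κ * ∫⁻ y in I (l k),
                ENNReal.ofReal ((f z - f y) ^ 2)) := by
            refine lintegral_mono fun z => ?_
            rw [← hvol k, mul_comm (volume _), ← setLIntegral_const,
              ← lintegral_const_mul' _ _ ENNReal.ofReal_ne_top,
              ← lintegral_add_left measurable_const]
            refine lintegral_mono fun y => ?_
            rw [← ENNReal.ofReal_mul hlam0.le, ← ENNReal.ofReal_mul hκ0.le,
              ← ENNReal.ofReal_add (by positivity) (by positivity)]
            refine ENNReal.ofReal_le_ofReal ?_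
            -- Weighted Young inequality, with its defect written as a perfect square.
            have h5 : lam * (f r - f z) ^ 2 + κ * (f z - f y) ^ 2 - (f r - f y) ^ 2 =
                ((lam - 1) * (f r - f z) - (f z - f y)) ^ 2 / (lam - 1) := by
              rw [hκ]; field_simp; ring
            have h6 : 0 ≤ ((lam - 1) * (f r - f z) - (f z - f y)) ^ 2 / (lam - 1) := by positivity
            linarith
        _ = ENNReal.ofReal (l k) * ENNReal.ofReal lam * e (k + 1) + ENNReal.ofReal κ *
              ∫⁻ z in I (l (k + 1)), ∫⁻ y in I (l k), ENNReal.ofReal ((f z - f y) ^ 2) := by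
            rw [lintegral_add_left (by fun_prop), lintegral_const_mul' _ _ ENNReal.ofReal_ne_top,
              lintegral_const_mul' _ _ ENNReal.ofReal_ne_top,
              lintegral_const_mul' _ _ ENNReal.ofReal_ne_top, mul_assoc]
        _ ≤ ENNReal.ofReal (l k) * ENNReal.ofReal lam * e (k + 1) + ENNReal.ofReal κ *
              (ENNReal.ofReal ((2 * l k) ^ p) * J) := by gcongr
        _ = _ := by
            have a1 : ENNReal.ofReal (l k) * ENNReal.ofReal lam =
                ENNReal.ofReal (l (k + 1)) * ENNReal.ofReal (2 * lam) := by
              rw [← ENNReal.ofReal_mul (hl0 _).le, ← ENNReal.ofReal_mul (hl0 _).le, hls k]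
              congr 1; ring
            have a2 : ENNReal.ofReal κ * ENNReal.ofReal ((2 * l k) ^ p) =
                ENNReal.ofReal (l (k + 1)) *
                  (ENNReal.ofReal (B * d ^ (2 * s)) * ENNReal.ofReal q ^ k) := by
              rw [← ENNReal.ofReal_pow hq0.le, ← ENNReal.ofReal_mul hκ0.le,
                ← ENNReal.ofReal_mul (by positivity), ← ENNReal.ofReal_mul (hl0 _).le]
              congr 1
              have h7 : l k ^ p = l k * (d ^ (2 * s) * q ^ k) := by
                rw [hp, Real.rpow_add (hl0 k), Real.rpow_one]
                congr 1
                simp only [hl]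
                rw [Real.mul_rpow hd.le (by positivity), hq, Real.rpow_neg (by norm_num),
                  ← Real.inv_rpow (by norm_num), ← Real.rpow_natCast, ← Real.rpow_natCast,
                  ← Real.rpow_mul (by norm_num), ← Real.rpow_mul (by norm_num), one_div,
                  mul_comm (k : ℝ)]
              rw [Real.mul_rpow (by norm_num) (hl0 k).le, h7, hls k, hB]; ring
            rw [mul_add, a1, ← mul_assoc (ENNReal.ofReal κ), a2]; ring
    exact (ENNReal.mul_le_mul_iff_right hne ENNReal.ofReal_ne_top).1 hmain
  -- Finiteness of the inner integral at `r` forces `e k` to decay like `2^(-pk)`. This replaces any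
  -- continuity of `f` at `r`, so no representative has to be chosen.
  have hdecay : ∀ k, e k ≤ (ENNReal.ofReal (d ^ p) *
      ∫⁻ y in S, ENNReal.ofReal ((f r - f y) ^ 2 / |r - y| ^ p)) *
        ENNReal.ofReal ((1 / 2) ^ p) ^ k := by
    intro k
    have h8 : ENNReal.ofReal (d ^ p) * ENNReal.ofReal ((1 / 2) ^ p) ^ k =
        ENNReal.ofReal (l k ^ p) := by
      rw [← ENNReal.ofReal_pow (by positivity), ← ENNReal.ofReal_mul (by positivity)]
      congr 1
      simp only [hl]
      rw [Real.mul_rpow hd.le (by positivity), ← Real.rpow_natCast, ← Real.rpow_natCast,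
        ← Real.rpow_mul (by norm_num), ← Real.rpow_mul (by norm_num), mul_comm (k : ℝ)]
    rw [mul_right_comm, h8, ← lintegral_const_mul' _ _ ENNReal.ofReal_ne_top]
    refine le_trans ?_ (lintegral_mono_set (hsub k))
    refine setLIntegral_mono' (hIm _) fun y hy => ?_
    refine ofReal_sq_le_mul_div_rpow hp0 (abs_nonneg _) ?_ ?_
    · rw [abs_sub_comm]; exact hdist k y hy
    · intro h
      rw [sub_eq_zero.1 (abs_eq_zero.1 h), sub_self]
  have hE0 : e 0 ≤ (ENNReal.ofReal (B * d ^ (2 * s)) * J) *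
      (1 - ENNReal.ofReal (2 * lam) * ENNReal.ofReal q)⁻¹ := by
    refine ENNReal.le_of_geometric_recursion (ENNReal.mul_ne_top ENNReal.ofReal_ne_top hg) ?_
      hrec hdecay
    rw [← ENNReal.ofReal_mul (by positivity), ENNReal.ofReal_lt_one]
    have : 2 * lam * ((1 : ℝ) / 2) ^ p = lam * q := by
      rw [hp, hq, Real.rpow_add (by norm_num), Real.rpow_one, one_div,
        Real.inv_rpow (by norm_num), Real.rpow_neg (by norm_num)]
      ring
    rw [this]
    nlinarith
  have hgeo : (1 - ENNReal.ofReal (2 * lam) * ENNReal.ofReal q)⁻¹ =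
      ENNReal.ofReal ((1 - 2 * lam * q)⁻¹) := by
    rw [← ENNReal.ofReal_mul (by positivity), ← ENNReal.ofReal_one,
      ← ENNReal.ofReal_sub _ (by positivity), ENNReal.ofReal_inv_of_pos (by linarith)]
  have hfin : ENNReal.ofReal d * ENNReal.ofReal (f r ^ 2) ≤
      2 * e 0 + 2 * ∫⁻ y in S, ENNReal.ofReal (f y ^ 2) := by
    have hv := hvol 0
    have hl00 : l 0 = d := by simp [hl]
    rw [hl00] at hv
    calc _ = ∫⁻ y in I (l 0), ENNReal.ofReal (f r ^ 2) := by
          rw [setLIntegral_const, hl00, hv, mul_comm]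
      _ ≤ ∫⁻ y in I (l 0), (2 * ENNReal.ofReal ((f r - f y) ^ 2) +
            2 * ENNReal.ofReal (f y ^ 2)) := by
          refine lintegral_mono fun y => ?_
          rw [← ENNReal.ofReal_ofNat 2, ← ENNReal.ofReal_mul (by norm_num),
            ← ENNReal.ofReal_mul (by norm_num), ← ENNReal.ofReal_add (by positivity) (by positivity)]
          refine ENNReal.ofReal_le_ofReal ?_
          nlinarith [sq_nonneg (f r - 2 * f y)]
      _ = 2 * e 0 + 2 * ∫⁻ y in I (l 0), ENNReal.ofReal (f y ^ 2) := by
          rw [lintegral_add_left (by fun_prop), lintegral_const_mul' _ _ (by norm_num),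
            lintegral_const_mul' _ _ (by norm_num)]
      _ ≤ _ := by
          gcongr
          exact hsub 0
  refine hfin.trans (add_le_add_left ?_ _)
  refine (mul_le_mul_right hE0 _).trans (le_of_eq ?_)
  rw [hgeo, mul_right_comm _ J, ← mul_assoc, ← ENNReal.ofReal_mul (by positivity),
    ← ENNReal.ofReal_ofNat 2, ← ENNReal.ofReal_mul (by norm_num)]
  congr 2
  ring

end Chaining

/-! ### Radial null sets and measurable profiles. -/

section RadialProfile

variable {E : Type*} [NormedAddCommGroup E] [NormedSpace ℝ E] [FiniteDimensional ℝ E]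
  [MeasurableSpace E] [BorelSpace E] [Nontrivial E] (μ : Measure E) [μ.IsAddHaarMeasure]

/-- A null set of radii meets every ray in a null set, so polar integration of its indicator gives
`0`. The origin, where the hypothesis says nothing, is itself null. -/
theorem ae_norm_of_ae {p : ℝ → Prop} (hp : ∀ᵐ r, 0 < r → p r) : ∀ᵐ x ∂μ, p ‖x‖ := by
  set T := toMeasurable volume {r : ℝ | ¬ (0 < r → p r)} with hT
  have hTm : MeasurableSet T := measurableSet_toMeasurable _ _
  have hT0 : volume T = 0 := by rw [hT, measure_toMeasurable]; exact hp
  have hind : Measurable (T.indicator (1 : ℝ → ℝ≥0∞)) := measurable_one.indicator hTm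
  have h0 : ∫⁻ x, T.indicator 1 ‖x‖ ∂μ = 0 := by
    have hm : Measurable (fun x : E => T.indicator (1 : ℝ → ℝ≥0∞) ‖x‖) :=
      hind.comp measurable_norm
    rw [lintegral_eq_lintegral_sphere_Ioi μ hm, ← lintegral_zero (μ := μ.toSphere)]
    refine lintegral_congr fun ω => ?_
    rw [← lintegral_zero (μ := volume.restrict (Set.Ioi (0 : ℝ)))]
    refine lintegral_congr_ae ?_
    have hTae : ∀ᵐ r : ℝ, r ∉ T := measure_eq_zero_iff_ae_notMem.1 hT0
    filter_upwards [ae_restrict_of_ae hTae, ae_restrict_mem measurableSet_Ioi] with r hr hr0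
    have : ‖r • (ω : E)‖ = r := by
      rw [norm_smul, Real.norm_of_nonneg (le_of_lt hr0)]; simp
    rw [this, Set.indicator_of_notMem hr, mul_zero]
  replace h0 := (lintegral_eq_zero_iff (hind.comp measurable_norm)).1 h0
  have hne : ∀ᵐ x ∂μ, x ≠ 0 := by simp [ae_iff]
  filter_upwards [h0, hne] with x hx hx0
  by_contra hcon
  have hmem : ‖x‖ ∈ T := subset_toMeasurable _ _ (by simpa [hx0] using hcon)
  simp [Set.indicator_of_mem hmem] at hx

/-- An almost everywhere radial measurable function on a ball has a measurable profile. -/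
theorem exists_measurable_profile {u : E → ℝ} {R : ℝ} {f : ℝ → ℝ}
    (hu : AEStronglyMeasurable u (μ.restrict (Metric.ball 0 R)))
    (hf : ∀ᵐ x ∂μ.restrict (Metric.ball 0 R), u x = f ‖x‖) :
    ∃ g : ℝ → ℝ, Measurable g ∧ ∀ᵐ x ∂μ.restrict (Metric.ball 0 R), u x = g ‖x‖ := by
  have hB : MeasurableSet (Metric.ball (0 : E) R) := Metric.isOpen_ball.measurableSet
  have h1 : ∀ᵐ x ∂μ, x ∈ Metric.ball (0 : E) R → hu.mk u x = f ‖x‖ := by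
    rw [← ae_restrict_iff' hB]
    filter_upwards [hu.ae_eq_mk, hf] with x h2 h3
    rw [← h2, h3]
  have : (ae μ.toSphere).NeBot := ae_neBot.2 μ.toSphere_ne_zero
  obtain ⟨ω, hω⟩ := (ae_polar_of_ae μ h1).exists
  -- `f` may fail to be measurable; a measurable representative of `u` read along one generic ray
  -- agrees with it at almost every radius in range.
  refine ⟨fun r => hu.mk u (r • (ω : E)), hu.measurable_mk.comp (by fun_prop), ?_⟩
  rw [ae_restrict_iff' measurableSet_Ioi] at hω
  have h4 := ae_norm_of_ae μ hω
  filter_upwards [hf, ae_restrict_of_ae h4, ae_restrict_mem hB] with x h5 h6 h7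
  have hωn : ‖(ω : E)‖ = 1 := by simp
  have h8 : ‖‖x‖ • (ω : E)‖ = ‖x‖ := by rw [norm_smul, hωn, mul_one, norm_norm]
  rw [h5, h6, h8]
  rw [mem_ball_zero_iff] at h7 ⊢
  rwa [h8]

end RadialProfile

theorem normLp_two_sq (N : ℕ) (Ω : Set (EuclideanSpace ℝ (Fin N)))
    (u : EuclideanSpace ℝ (Fin N) → ℝ) :
    normLp N 2 Ω u ^ 2 = ∫⁻ x in Ω, ENNReal.ofReal (u x ^ 2) := by
  rw [normLp, eLpNorm_eq_lintegral_rpow_enorm_toReal (by simp) (by simp),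
    ENNReal.toReal_ofReal (by norm_num), ← ENNReal.rpow_natCast, ← ENNReal.rpow_mul]
  norm_num
  refine lintegral_congr fun x => ?_
  rw [← ofReal_norm, ← ENNReal.ofReal_pow (norm_nonneg _), Real.norm_eq_abs, sq_abs]

/-! ### Smallness of the critical norm away from the origin. -/

section Annulus

/-- Away from the origin, radial functions are bounded by an arbitrarily small multiple of the
Gagliardo form plus a multiple of the `L²` norm. -/
theorem ae_sq_profile_le {N : ℕ} (hN : 2 ≤ N) {s : ℝ} (hs : 1 / 2 < s) {ε : ℝ} (hε : 0 < ε) :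
    ∃ C : ℝ, 0 < C ∧ ∀ f : ℝ → ℝ, Measurable f →
      ∀ᵐ r ∂volume.restrict (Set.Ioo (1 / 2 : ℝ) 1), ENNReal.ofReal (f r ^ 2) ≤
        ENNReal.ofReal ε * (∫⁻ x in Metric.ball (0 : EuclideanSpace ℝ (Fin N)) 1,
          ∫⁻ y in Metric.ball (0 : EuclideanSpace ℝ (Fin N)) 1,
            ENNReal.ofReal ((f ‖x‖ - f ‖y‖) ^ 2 / ‖x - y‖ ^ ((N : ℝ) + 2 * s))) +
        ENNReal.ofReal C * ∫⁻ x in Metric.ball (0 : EuclideanSpace ℝ (Fin N)) 1,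
          ENNReal.ofReal (f ‖x‖ ^ 2) := by
  have : Nonempty (Fin N) := ⟨⟨0, by omega⟩⟩
  have hfr : Module.finrank ℝ (EuclideanSpace ℝ (Fin N)) = N := by simp
  obtain ⟨c, hc, hcJ⟩ := gagliardoSq_le_of_radial hN (s := s) (a := 1 / 2) (by linarith)
    (by norm_num)
  obtain ⟨K, hK, hKJ⟩ := sq_le_gagliardoSq_add hs
  set V : ℝ := (volume (Metric.ball (0 : EuclideanSpace ℝ (Fin N)) 1)).toReal with hV
  have hVt : volume (Metric.ball (0 : EuclideanSpace ℝ (Fin N)) 1) ≠ ⊤ := measure_ball_lt_top.ne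
  have hV0 : 0 < V := ENNReal.toReal_pos
    (Metric.isOpen_ball.measure_pos _ ⟨0, by simp⟩).ne' hVt
  have h2s : 0 < 2 * s - 1 := by linarith
  -- The scale at which `K d^(2s)`, after division by `d`, is at most `ε * c`. The cap `1/4` on `d`
  -- lets an interval of length `d` next to `r` fit inside `(1/2, 1)`.
  set t : ℝ := (ε * c / K) ^ (1 / (2 * s - 1)) with ht
  have ht0 : 0 < t := by positivity
  set d : ℝ := min (1 / 4) t with hd
  have hd0 : 0 < d := lt_min (by norm_num) ht0
  have hd4 : d ≤ 1 / 4 := min_le_left _ _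
  have hdK : K * d ^ (2 * s) ≤ d * (ε * c) := by
    have h1 : d ^ (2 * s - 1) ≤ ε * c / K := by
      calc d ^ (2 * s - 1) ≤ t ^ (2 * s - 1) :=
            Real.rpow_le_rpow hd0.le (min_le_right _ _) h2s.le
        _ = ε * c / K := by
            rw [ht, ← Real.rpow_mul (by positivity), one_div_mul_cancel h2s.ne', Real.rpow_one]
    have h2 : d ^ (2 * s) = d * d ^ (2 * s - 1) := by
      rw [← Real.rpow_one_add' hd0.le (by linarith)]; congr 1; ring
    rw [le_div_iff₀ hK] at h1
    rw [h2]
    nlinarith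
  set b : ℝ := (1 / 2 : ℝ) ^ (N - 1) * (N * V) with hb
  have hb0 : 0 < b := by positivity
  refine ⟨2 / (d * b), by positivity, fun f hf => ?_⟩
  obtain ⟨G, hG⟩ : ∃ G, G = ∫⁻ x in Metric.ball (0 : EuclideanSpace ℝ (Fin N)) 1, ∫⁻ y in Metric.ball (0 : EuclideanSpace ℝ (Fin N)) 1,
      ENNReal.ofReal ((f ‖x‖ - f ‖y‖) ^ 2 / ‖x - y‖ ^ ((N : ℝ) + 2 * s)) := ⟨_, rfl⟩
  obtain ⟨F, hF⟩ : ∃ F, F = ∫⁻ x in Metric.ball (0 : EuclideanSpace ℝ (Fin N)) 1, ENNReal.ofReal (f ‖x‖ ^ 2) := ⟨_, rfl⟩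
  have hJG := hcJ f hf
  rw [← hG] at hJG
  rw [← hG, ← hF]
  set S : Set ℝ := Set.Ioo (1 / 2 : ℝ) 1 with hS
  have hL2 : ENNReal.ofReal b * ∫⁻ r in S, ENNReal.ofReal (f r ^ 2) ≤ F := by
    have h3 : Measurable (fun x : EuclideanSpace ℝ (Fin N) => ENNReal.ofReal (f ‖x‖ ^ 2)) := by fun_prop
    have h4 := lintegral_sphere_Ioo_le volume h3 (a := 1 / 2) (by norm_num)
    rw [← hF, hfr] at h4
    refine le_trans (le_of_eq ?_) h4
    have h5 : ∀ ω : Metric.sphere (0 : EuclideanSpace ℝ (Fin N)) 1, ∫⁻ r in S, ENNReal.ofReal (f ‖r • (ω : EuclideanSpace ℝ (Fin N))‖ ^ 2) =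
        ∫⁻ r in S, ENNReal.ofReal (f r ^ 2) := by
      intro ω
      refine setLIntegral_congr_fun measurableSet_Ioo fun r hr => ?_
      have hr0 : (0 : ℝ) ≤ r := le_trans (by norm_num) hr.1.le
      have : ‖r • (ω : EuclideanSpace ℝ (Fin N))‖ = r := by rw [norm_smul, Real.norm_of_nonneg hr0]; simp
      simp only [this]
    simp_rw [← hS, h5]
    rw [lintegral_const, Measure.toSphere_apply_univ, hfr, ← ENNReal.ofReal_toReal hVt, ← hV, hb,
      ENNReal.ofReal_mul (by positivity), ENNReal.ofReal_mul (p := (N : ℝ)) (by positivity),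
      ENNReal.ofReal_natCast]
    ring
  have hm : Measurable (fun q : ℝ × ℝ =>
      ENNReal.ofReal ((f q.1 - f q.2) ^ 2 / |q.1 - q.2| ^ (1 + 2 * s))) := by fun_prop
  by_cases hJ : gagliardoSq s S f = ⊤
  · have hGt : G = ⊤ := by
      rw [hJ, ENNReal.mul_top (by simpa using hc)] at hJG
      exact top_le_iff.1 hJG
    have : ENNReal.ofReal ε * G = ⊤ := by rw [hGt, ENNReal.mul_top (by simpa using hε)]
    simp [this]
  have hfin : ∀ᵐ r ∂volume.restrict S, ∫⁻ y in S,
      ENNReal.ofReal ((f r - f y) ^ 2 / |r - y| ^ (1 + 2 * s)) < ⊤ :=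
    ae_lt_top hm.lintegral_prod_right' hJ
  filter_upwards [hfin, ae_restrict_mem measurableSet_Ioo] with r hr hrS
  have hchain : ENNReal.ofReal d * ENNReal.ofReal (f r ^ 2) ≤
      ENNReal.ofReal (K * d ^ (2 * s)) * gagliardoSq s S f +
        2 * ∫⁻ y in S, ENNReal.ofReal (f y ^ 2) := by
    -- One-sided intervals pointing into `S`: to the right of `r` in its left half, to the left
    -- otherwise.
    rcases le_total r (3 / 4) with h | h
    · refine hKJ f hf S (fun l => Set.Ioo r (r + l)) r d hd0 (fun l => measurableSet_Ioo) ?_ hr.ne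
      intro l hl hld
      refine ⟨by rw [Real.volume_Ioo]; congr 1; ring, fun y hy => ?_, fun y hy => ?_⟩
      · exact ⟨hrS.1.trans hy.1, by linarith [hy.2, hrS.2]⟩
      · rw [abs_le]; constructor <;> linarith [hy.1, hy.2]
    · refine hKJ f hf S (fun l => Set.Ioo (r - l) r) r d hd0 (fun l => measurableSet_Ioo) ?_ hr.ne
      intro l hl hld
      refine ⟨by rw [Real.volume_Ioo]; congr 1; ring, fun y hy => ?_, fun y hy => ?_⟩
      · exact ⟨by linarith [hy.1], hy.2.trans hrS.2⟩
      · rw [abs_le]; constructor <;> linarith [hy.1, hy.2]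
  have hd' : ENNReal.ofReal d ≠ 0 := by simpa using hd0
  have hb' : ENNReal.ofReal b ≠ 0 := by simpa using hb0
  refine (ENNReal.mul_le_mul_iff_right hd' ENNReal.ofReal_ne_top).1 (hchain.trans ?_)
  rw [mul_add]
  refine add_le_add ?_ ?_
  · calc _ ≤ ENNReal.ofReal (d * (ε * c)) * gagliardoSq s S f := by gcongr
      _ = ENNReal.ofReal d * (ENNReal.ofReal ε * (ENNReal.ofReal c * gagliardoSq s S f)) := by
          rw [ENNReal.ofReal_mul hd0.le, ENNReal.ofReal_mul hε.le]; ring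
      _ ≤ _ := by gcongr
  · calc _ = ENNReal.ofReal d * (ENNReal.ofReal (2 / (d * b)) *
          (ENNReal.ofReal b * ∫⁻ y in S, ENNReal.ofReal (f y ^ 2))) := by
          rw [← mul_assoc, ← mul_assoc, ← ENNReal.ofReal_mul hd0.le,
            ← ENNReal.ofReal_mul (by positivity), ← ENNReal.ofReal_ofNat 2]
          congr 2
          field_simp
      _ ≤ _ := by gcongr

theorem fracLapConst_pos {N : ℕ} {s : ℝ} (hs : 0 < s) (hs' : s < 1) : 0 < fracLapConst N s := by
  have h1 : 0 < Real.Gamma ((N : ℝ) / 2 + s) := Real.Gamma_pos_of_pos (by positivity)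
  have h2 : 0 < Real.Gamma (1 - s) := Real.Gamma_pos_of_pos (by linarith)
  rw [fracLapConst]
  positivity

/-- The compactness-type inequality for radial functions vanishing near the origin. -/
theorem normLp_sq_le_of_radial {N : ℕ} (hN : 2 ≤ N) {s : ℝ} (hs : 1 / 2 < s) (hs' : s < 1) (p : ℝ)
    {ε : ℝ} (hε : 0 < ε) :
    ∃ C : ℝ, 0 < C ∧ ∀ f : ℝ → ℝ, Measurable f → (∀ r, 0 ≤ r → r ≤ 1 / 2 → f r = 0) →
      normLp N p (Metric.ball 0 1) (fun x => f ‖x‖) ^ 2 ≤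
        ENNReal.ofReal ε * regionalForm N s (Metric.ball 0 1) (fun x => f ‖x‖) +
          ENNReal.ofReal C * normLp N 2 (Metric.ball 0 1) (fun x => f ‖x‖) ^ 2 := by
  have : Nonempty (Fin N) := ⟨⟨0, by omega⟩⟩
  have hVt : volume (Metric.ball (0 : EuclideanSpace ℝ (Fin N)) 1) ≠ ⊤ := measure_ball_lt_top.ne
  set W : ℝ≥0∞ := (volume (Metric.ball (0 : EuclideanSpace ℝ (Fin N)) 1) ^ (ENNReal.ofReal p).toReal⁻¹) ^ 2 with hW
  have hWt : W ≠ ⊤ := ENNReal.pow_ne_top (ENNReal.rpow_ne_top_of_nonneg (by positivity) hVt)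
  have hc := fracLapConst_pos (N := N) (s := s) (by linarith) hs'
  set c := fracLapConst N s / 2 with hcdef
  have hc0 : 0 < c := by positivity
  set w : ℝ := W.toReal + 1 with hw
  have hw0 : 0 < w := by positivity
  have hWw : W ≤ ENNReal.ofReal w := by
    rw [← ENNReal.ofReal_toReal hWt]; exact ENNReal.ofReal_le_ofReal (by linarith)
  -- `c` is the normalization inside `regionalForm`; `w` dominates the volume factor `W` lost in
  -- passing from the sup bound to `L^p`.
  obtain ⟨C, hC, hmain⟩ := ae_sq_profile_le hN hs (ε := ε * c / w) (by positivity)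
  refine ⟨C * w, by positivity, fun f hf hf0 => ?_⟩
  have h1 := hmain f hf
  rw [normLp_two_sq, regionalForm, ← hcdef]
  obtain ⟨G, hG⟩ : ∃ G, G = ∫⁻ x in Metric.ball (0 : EuclideanSpace ℝ (Fin N)) 1, ∫⁻ y in Metric.ball (0 : EuclideanSpace ℝ (Fin N)) 1,
      ENNReal.ofReal ((f ‖x‖ - f ‖y‖) ^ 2 / ‖x - y‖ ^ ((N : ℝ) + 2 * s)) := ⟨_, rfl⟩
  obtain ⟨F, hF⟩ : ∃ F, F = ∫⁻ x in Metric.ball (0 : EuclideanSpace ℝ (Fin N)) 1, ENNReal.ofReal (f ‖x‖ ^ 2) := ⟨_, rfl⟩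
  rw [← hG, ← hF] at h1
  rw [← hG, ← hF]
  set M := ENNReal.ofReal (ε * c / w) * G + ENNReal.ofReal C * F with hM
  rw [ae_restrict_iff' measurableSet_Ioo] at h1
  have h2 : ∀ᵐ x ∂volume.restrict (Metric.ball (0 : EuclideanSpace ℝ (Fin N)) 1), ‖f ‖x‖‖ₑ ≤ M ^ (1 / 2 : ℝ) := by
    have h3 := ae_norm_of_ae (volume : Measure (EuclideanSpace ℝ (Fin N))) (h1.mono fun r hr (_ : 0 < r) => hr)
    filter_upwards [ae_restrict_of_ae h3, ae_restrict_mem Metric.isOpen_ball.measurableSet]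
      with x h4 h5
    rw [mem_ball_zero_iff] at h5
    rcases le_or_gt ‖x‖ (1 / 2) with h6 | h6
    · rw [hf0 _ (norm_nonneg _) h6]; simp
    · have h7 := ENNReal.rpow_le_rpow (h4 ⟨h6, h5⟩) (show (0 : ℝ) ≤ 1 / 2 by norm_num)
      refine le_trans (le_of_eq ?_) h7
      rw [← sq_abs, ENNReal.ofReal_pow (abs_nonneg _), ← ENNReal.rpow_natCast, ← ENNReal.rpow_mul,
        ← ofReal_norm, Real.norm_eq_abs]
      norm_num
  have h8 := eLpNorm_le_of_ae_enorm_bound (p := ENNReal.ofReal p) h2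
  rw [Measure.restrict_apply_univ, smul_eq_mul] at h8
  calc normLp N p (Metric.ball 0 1) (fun x => f ‖x‖) ^ 2
      ≤ (M ^ (1 / 2 : ℝ) * volume (Metric.ball (0 : EuclideanSpace ℝ (Fin N)) 1) ^ (ENNReal.ofReal p).toReal⁻¹) ^ 2 := by
        gcongr; exact h8
    _ = M * W := by
        rw [mul_pow, ← ENNReal.rpow_natCast (M ^ (1 / 2 : ℝ)), ← ENNReal.rpow_mul]
        norm_num [hW]
    _ ≤ M * ENNReal.ofReal w := by gcongr
    _ = _ := by
        rw [hM, ENNReal.ofReal_div_of_pos hw0, ENNReal.ofReal_mul hε.le, ENNReal.ofReal_mul hC.le,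
          add_mul, mul_right_comm, ENNReal.div_mul_cancel (by simpa using hw0) ENNReal.ofReal_ne_top]
        ring

end Annulus

/-! ### Partition of unity, IMS localization and extension by zero. -/

section Localization

/-- A radial angle function `θ(‖x‖)` whose cosine and sine form a quadratic partition of unity. -/
theorem exists_radial_angle (N : ℕ) :
    ∃ (θ : ℝ → ℝ) (L : ℝ), Continuous θ ∧ 0 < L ∧
      (∀ x y : EuclideanSpace ℝ (Fin N), |θ ‖x‖ - θ ‖y‖| ≤ L * ‖x - y‖) ∧
      ContDiff ℝ ((⊤ : ℕ∞) : WithTop ℕ∞) (fun x : EuclideanSpace ℝ (Fin N) => θ ‖x‖) ∧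
      (∀ r, 0 ≤ r → r ≤ 1 / 2 → θ r = 0) ∧ ∀ r, 3 / 4 ≤ r → θ r = Real.pi / 2 := by
  -- Using `r ^ 2` rather than `r` keeps `θ ‖x‖` smooth at the origin. The argument is `≤ 0` for `0
  -- ≤ r ≤ 1/2` and already `5/4` at `r = 3/4`.
  set θ : ℝ → ℝ := fun r => Real.pi / 2 * Real.smoothTransition (4 * r ^ 2 - 1) with hθ
  have hcd : ContDiff ℝ ((⊤ : ℕ∞) : WithTop ℕ∞)
      (fun x : EuclideanSpace ℝ (Fin N) => θ ‖x‖) := by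
    simp only [hθ]
    exact contDiff_const.mul (Real.smoothTransition.contDiff.comp
      ((contDiff_const.mul (contDiff_norm_sq ℝ)).sub contDiff_const))
  have hone : ∀ r, 3 / 4 ≤ r → θ r = Real.pi / 2 := fun r hr => by
    simp only [hθ]
    rw [Real.smoothTransition.one_of_one_le (by nlinarith), mul_one]
  have hsupp : HasCompactSupport
      (fun x : EuclideanSpace ℝ (Fin N) => Real.pi / 2 - θ ‖x‖) := by
    refine HasCompactSupport.intro (isCompact_closedBall 0 (3 / 4)) fun x hx => ?_
    rw [mem_closedBall_zero_iff, not_le] at hx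
    rw [hone _ hx.le, sub_self]
  obtain ⟨C, hC⟩ := ContDiff.lipschitzWith_of_hasCompactSupport (𝕂 := ℝ) hsupp
    (contDiff_const.sub hcd) (by simp)
  refine ⟨θ, C + 1, ?_, by positivity, fun x y => ?_, hcd, fun r h0 h1 => ?_, hone⟩
  · exact continuous_const.mul (Real.smoothTransition.continuous.comp (by fun_prop))
  · have h := hC.dist_le_mul x y
    rw [Real.dist_eq, dist_eq_norm, sub_sub_sub_cancel_left, abs_sub_comm] at h
    nlinarith [norm_nonneg (x - y)]
  · simp only [hθ]
    rw [Real.smoothTransition.zero_of_nonpos (by nlinarith), mul_zero]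

theorem lintegral_lintegral_add_left {α β : Type*} [MeasurableSpace α] [MeasurableSpace β]
    {μ : Measure α} {ν : Measure β} [SFinite ν] {K : α → β → ℝ≥0∞}
    (hK : Measurable (Function.uncurry K)) (H : α → β → ℝ≥0∞) :
    ∫⁻ x, ∫⁻ y, (K x y + H x y) ∂ν ∂μ = ∫⁻ x, ∫⁻ y, K x y ∂ν ∂μ + ∫⁻ x, ∫⁻ y, H x y ∂ν ∂μ := by
  have h : Measurable (fun x => ∫⁻ y, K x y ∂ν) := hK.lintegral_prod_right'
  rw [← lintegral_add_left h]
  exact lintegral_congr fun x => lintegral_add_left hK.of_uncurry_left _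

/-- A Schur test for convolution kernels. -/
theorem lintegral_add_mul_kernel_le {G : Type*} [AddCommGroup G] [MeasurableSpace G]
    [MeasurableAdd₂ G] [MeasurableNeg G] {μ : Measure G} [SFinite μ] [μ.IsAddLeftInvariant]
    [μ.IsNegInvariant] {k F : G → ℝ≥0∞} (hk : Measurable k) (hF : Measurable F)
    (hk' : ∀ z, k (-z) = k z) (Ω : Set G) :
    ∫⁻ x in Ω, ∫⁻ y in Ω, (F x + F y) * k (x - y) ∂μ ∂μ ≤
      2 * (∫⁻ z, k z ∂μ) * ∫⁻ x in Ω, F x ∂μ := by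
  have hkm : Measurable (fun q : G × G => k (q.1 - q.2)) := hk.comp (by fun_prop)
  have h1 : ∫⁻ x in Ω, ∫⁻ y in Ω, F x * k (x - y) ∂μ ∂μ ≤ (∫⁻ z, k z ∂μ) * ∫⁻ x in Ω, F x ∂μ := by
    rw [← lintegral_const_mul _ hF]
    refine lintegral_mono fun x => ?_
    have hkx : Measurable (fun y => k (x - y)) := hkm.comp measurable_prodMk_left
    rw [lintegral_const_mul _ hkx, mul_comm]
    refine mul_le_mul_left ?_ _
    refine (setLIntegral_le_lintegral _ _).trans (le_of_eq ?_)
    exact lintegral_sub_left_eq_self k x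
  have h2 : ∫⁻ x in Ω, ∫⁻ y in Ω, F y * k (x - y) ∂μ ∂μ =
      ∫⁻ x in Ω, ∫⁻ y in Ω, F x * k (x - y) ∂μ ∂μ := by
    have hm : Measurable (fun q : G × G => F q.2 * k (q.1 - q.2)) :=
      (hF.comp measurable_snd).mul hkm
    rw [lintegral_lintegral_swap hm.aemeasurable]
    refine lintegral_congr fun x => lintegral_congr fun y => ?_
    rw [← hk' (x - y), neg_sub]
  have hm1 : Measurable (fun q : G × G => F q.1 * k (q.1 - q.2)) :=
    (hF.comp measurable_fst).mul hkm
  calc _ = ∫⁻ x in Ω, ∫⁻ y in Ω, F x * k (x - y) ∂μ ∂μ +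
        ∫⁻ x in Ω, ∫⁻ y in Ω, F y * k (x - y) ∂μ ∂μ := by
        simp_rw [add_mul]
        exact lintegral_lintegral_add_left (K := fun x y => F x * k (x - y)) hm1 _
    _ ≤ _ := by
        rw [h2, mul_assoc, two_mul]
        exact add_le_add h1 h1

/-- The kernel left after the cutoff's Lipschitz bound gains `|x - y|²`. It is integrable near `0`
because `N + 2s - 2 < N`, and truncation at `2` suffices since differences of points of the unit
ball are shorter than that. -/
theorem exists_near_kernel_bound {N : ℕ} (hN : 2 ≤ N) {s : ℝ} (hs' : s < 1) :
    ∃ k : EuclideanSpace ℝ (Fin N) → ℝ≥0∞, Measurable k ∧ (∀ z, k (-z) = k z) ∧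
      ∫⁻ z, k z ≠ ⊤ ∧ ∀ z, ‖z‖ < 2 → k z = ENNReal.ofReal (‖z‖ ^ (-((N : ℝ) + 2 * s - 2))) := by
  refine ⟨(Metric.ball 0 2).indicator
    (fun z => ENNReal.ofReal (‖z‖ ^ (-((N : ℝ) + 2 * s - 2)))), ?_, fun z => ?_, ?_, fun z hz => ?_⟩
  · exact Measurable.indicator (by fun_prop) Metric.isOpen_ball.measurableSet
  · simp [Set.indicator]
  · rw [lintegral_indicator Metric.isOpen_ball.measurableSet]
    have hm : AEStronglyMeasurable (fun z : EuclideanSpace ℝ (Fin N) =>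
        ‖z‖ ^ (-((N : ℝ) + 2 * s - 2))) volume :=
      (by fun_prop : Measurable _).aestronglyMeasurable
    have := integrableOn_ball_of_norm_le_rpow (μ := volume) (E := EuclideanSpace ℝ (Fin N))
      (by simp; omega) (C := 1) (α := (N : ℝ) + 2 * s - 2) (r := 2) (by simp; linarith)
      (Filter.Eventually.of_forall fun z => by
        rw [Real.norm_of_nonneg (by positivity), one_mul]) hm
    exact this.lintegral_lt_top.ne
  · rw [Set.indicator_of_mem (by simpa using hz)]

/-- The distance `1/4` separates `‖x‖ < 3/4` from the complement of the unit ball. There `1 + ‖z‖ ≤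
5 ‖z‖`, so `5^p (1 + ‖z‖)^(-p)` is an integrable majorant. -/
theorem exists_far_kernel_bound {N : ℕ} {s : ℝ} (hs : 0 < s) :
    ∃ k : EuclideanSpace ℝ (Fin N) → ℝ≥0∞, Measurable k ∧ (∀ z, k (-z) = k z) ∧
      ∫⁻ z, k z ≠ ⊤ ∧
      ∀ z, 1 / 4 ≤ ‖z‖ → ENNReal.ofReal (1 / ‖z‖ ^ ((N : ℝ) + 2 * s)) ≤ k z := by
  set p : ℝ := (N : ℝ) + 2 * s with hp
  have hp0 : 0 < p := by positivity
  refine ⟨fun z => ENNReal.ofReal (5 ^ p) * ENNReal.ofReal ((1 + ‖z‖) ^ (-p)),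
    by fun_prop, fun z => by simp, ?_, fun z hz => ?_⟩
  · rw [lintegral_const_mul _ (by fun_prop)]
    exact ENNReal.mul_ne_top ENNReal.ofReal_ne_top
      (finite_integral_one_add_norm (by simp; linarith)).ne
  · beta_reduce
    rw [← ENNReal.ofReal_mul (by positivity)]
    refine ENNReal.ofReal_le_ofReal ?_
    have hz0 : 0 < ‖z‖ := by linarith
    rw [Real.rpow_neg (by positivity), ← div_eq_mul_inv,
      div_le_div_iff₀ (by positivity) (by positivity), one_mul,
      ← Real.mul_rpow (by norm_num) hz0.le]
    exact Real.rpow_le_rpow (by positivity) (by linarith) hp0.le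

/-- The IMS localization formula for the regional form, up to an `L²` error. -/
theorem regionalForm_cos_add_sin_le {N : ℕ} (hN : 2 ≤ N) {s : ℝ} (hs' : s < 1)
    {θ : ℝ → ℝ} (hθ : Continuous θ) {L : ℝ}
    (hL : ∀ x y : EuclideanSpace ℝ (Fin N), |θ ‖x‖ - θ ‖y‖| ≤ L * ‖x - y‖) :
    ∃ C : ℝ, 0 < C ∧ ∀ u : EuclideanSpace ℝ (Fin N) → ℝ, Measurable u →
      regionalForm N s (Metric.ball 0 1) (fun x => Real.cos (θ ‖x‖) * u x) +
        regionalForm N s (Metric.ball 0 1) (fun x => Real.sin (θ ‖x‖) * u x) ≤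
      regionalForm N s (Metric.ball 0 1) u +
        ENNReal.ofReal C * normLp N 2 (Metric.ball 0 1) u ^ 2 := by
  obtain ⟨k, hk, hk', hkt, hkz⟩ := exists_near_kernel_bound hN hs'
  have hCt : ENNReal.ofReal (fracLapConst N s / 2) *
      (2 * (∫⁻ z, ENNReal.ofReal (L ^ 2) * k z)) ≠ ⊤ := by
    rw [lintegral_const_mul _ hk]
    exact ENNReal.mul_ne_top ENNReal.ofReal_ne_top (ENNReal.mul_ne_top (by simp)
      (ENNReal.mul_ne_top ENNReal.ofReal_ne_top hkt))
  -- The Schur constant of the error kernel, plus `1` to make it strictly positive.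
  refine ⟨(ENNReal.ofReal (fracLapConst N s / 2) *
    (2 * (∫⁻ z, ENNReal.ofReal (L ^ 2) * k z))).toReal + 1, by positivity, fun u hu => ?_⟩
  set p : ℝ := (N : ℝ) + 2 * s with hp
  have hθm : Measurable θ := hθ.measurable
  have hB : MeasurableSet (Metric.ball (0 : EuclideanSpace ℝ (Fin N)) 1) :=
    Metric.isOpen_ball.measurableSet
  have hker : ∀ v : EuclideanSpace ℝ (Fin N) → ℝ, Measurable v →
      Measurable (Function.uncurry fun x y : EuclideanSpace ℝ (Fin N) =>
        ENNReal.ofReal ((v x - v y) ^ 2 / ‖x - y‖ ^ p)) := fun v hv => by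
    simp only [Function.uncurry_def]
    fun_prop
  have hcu : Measurable (fun x => Real.cos (θ ‖x‖) * u x) := by fun_prop
  have hsu : Measurable (fun x => Real.sin (θ ‖x‖) * u x) := by fun_prop
  have hpt : ∀ x ∈ Metric.ball (0 : EuclideanSpace ℝ (Fin N)) 1,
      ∀ y ∈ Metric.ball (0 : EuclideanSpace ℝ (Fin N)) 1,
      ENNReal.ofReal ((Real.cos (θ ‖x‖) * u x - Real.cos (θ ‖y‖) * u y) ^ 2 / ‖x - y‖ ^ p) +
        ENNReal.ofReal ((Real.sin (θ ‖x‖) * u x - Real.sin (θ ‖y‖) * u y) ^ 2 / ‖x - y‖ ^ p) ≤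
      ENNReal.ofReal ((u x - u y) ^ 2 / ‖x - y‖ ^ p) +
        (ENNReal.ofReal (u x ^ 2) + ENNReal.ofReal (u y ^ 2)) *
          (ENNReal.ofReal (L ^ 2) * k (x - y)) := by
    intro x hx y hy
    rw [mem_ball_zero_iff] at hx hy
    have hd : ‖x - y‖ < 2 := (norm_sub_le x y).trans_lt (by linarith)
    rw [hkz _ hd, ← ENNReal.ofReal_mul (sq_nonneg L),
      ← ENNReal.ofReal_add (sq_nonneg _) (sq_nonneg _), ← ENNReal.ofReal_mul (by positivity),
      ← ENNReal.ofReal_add (by positivity) (by positivity),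
      ← ENNReal.ofReal_add (by positivity) (by positivity)]
    refine ENNReal.ofReal_le_ofReal ?_
    rcases eq_or_ne x y with rfl | hxy
    · simp only [sub_self, ne_eq, OfNat.ofNat_ne_zero, not_false_eq_true, zero_pow, zero_div,
        add_zero, zero_add]
      positivity
    have hd0 : 0 < ‖x - y‖ := norm_pos_iff.2 (sub_ne_zero.2 hxy)
    have hpow : ‖x - y‖ ^ (-(p - 2)) = ‖x - y‖ ^ 2 / ‖x - y‖ ^ p := by
      rw [neg_sub, Real.rpow_sub hd0]; norm_num
    rw [hpow, ← add_div, mul_div_assoc', mul_div_assoc', ← add_div]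
    refine div_le_div_of_nonneg_right ?_ (Real.rpow_nonneg hd0.le _)
    have hcos : 1 - (θ ‖x‖ - θ ‖y‖) ^ 2 / 2 ≤ Real.cos (θ ‖x‖ - θ ‖y‖) :=
      Real.one_sub_sq_div_two_le_cos
    have hsq : (θ ‖x‖ - θ ‖y‖) ^ 2 ≤ L ^ 2 * ‖x - y‖ ^ 2 := by
      rw [← mul_pow, ← sq_abs]
      exact pow_le_pow_left₀ (abs_nonneg _) (hL x y) 2
    have hle1 := Real.cos_le_one (θ ‖x‖ - θ ‖y‖)
    -- The exact localization identity. The coefficient of `(u x - u y)^2` is `1`, which is what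
    -- preserves the sharp constant.
    have hid : (Real.cos (θ ‖x‖) * u x - Real.cos (θ ‖y‖) * u y) ^ 2 +
        (Real.sin (θ ‖x‖) * u x - Real.sin (θ ‖y‖) * u y) ^ 2 =
        (u x - u y) ^ 2 + 2 * (u x * u y) * (1 - Real.cos (θ ‖x‖ - θ ‖y‖)) := by
      rw [Real.cos_sub]
      linear_combination (u x ^ 2) * Real.sin_sq_add_cos_sq (θ ‖x‖) +
        (u y ^ 2) * Real.sin_sq_add_cos_sq (θ ‖y‖)
    rw [hid]
    have h1 : 2 * (u x * u y) ≤ u x ^ 2 + u y ^ 2 := by nlinarith [sq_nonneg (u x - u y)]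
    have h2 : 0 ≤ 1 - Real.cos (θ ‖x‖ - θ ‖y‖) := by linarith
    have h3 : 1 - Real.cos (θ ‖x‖ - θ ‖y‖) ≤ L ^ 2 * ‖x - y‖ ^ 2 := by
      have : 0 ≤ L ^ 2 * ‖x - y‖ ^ 2 := by positivity
      linarith
    have h4 := mul_le_mul_of_nonneg_right h1 h2
    have h5 := mul_le_mul_of_nonneg_left h3 (show 0 ≤ u x ^ 2 + u y ^ 2 by positivity)
    linarith
  have hF : Measurable (fun x => ENNReal.ofReal (u x ^ 2)) := by fun_prop
  have hschur := lintegral_add_mul_kernel_le (μ := volume) (hk.const_mul (ENNReal.ofReal (L ^ 2)))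
    hF (fun z => by rw [hk']) (Metric.ball (0 : EuclideanSpace ℝ (Fin N)) 1)
  rw [normLp_two_sq]
  simp only [regionalForm, ← hp]
  rw [← mul_add]
  calc _ ≤ ENNReal.ofReal (fracLapConst N s / 2) *
        ((∫⁻ x in Metric.ball (0 : EuclideanSpace ℝ (Fin N)) 1,
          ∫⁻ y in Metric.ball (0 : EuclideanSpace ℝ (Fin N)) 1,
            ENNReal.ofReal ((u x - u y) ^ 2 / ‖x - y‖ ^ p)) +
        ∫⁻ x in Metric.ball (0 : EuclideanSpace ℝ (Fin N)) 1,
          ∫⁻ y in Metric.ball (0 : EuclideanSpace ℝ (Fin N)) 1,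
            (ENNReal.ofReal (u x ^ 2) + ENNReal.ofReal (u y ^ 2)) *
              (ENNReal.ofReal (L ^ 2) * k (x - y))) := by
        refine mul_le_mul_right ?_ _
        refine le_trans (le_of_eq (lintegral_lintegral_add_left (hker _ hcu) _).symm)
          (le_trans ?_ (le_of_eq (lintegral_lintegral_add_left (hker _ hu) _)))
        exact setLIntegral_mono' hB fun x hx => setLIntegral_mono' hB fun y hy => hpt x hx y hy
    _ ≤ _ := by
        rw [mul_add]
        refine add_le_add le_rfl ((mul_le_mul_right hschur _).trans ?_)
        rw [← mul_assoc]
        refine mul_le_mul_left ?_ _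
        rw [← ENNReal.ofReal_toReal hCt]
        exact ENNReal.ofReal_le_ofReal (by simp)

/-- Extension by zero of functions supported away from the boundary of the ball. -/
theorem regionalForm_univ_le {N : ℕ} {s : ℝ} (hs : 0 < s) :
    ∃ C : ℝ, 0 < C ∧ ∀ w : EuclideanSpace ℝ (Fin N) → ℝ, Measurable w →
      (∀ x, 3 / 4 ≤ ‖x‖ → w x = 0) →
      regionalForm N s Set.univ w ≤ regionalForm N s (Metric.ball 0 1) w +
        ENNReal.ofReal C * normLp N 2 (Metric.ball 0 1) w ^ 2 := by
  obtain ⟨k, hk, hk', hkt, hkz⟩ := exists_far_kernel_bound (N := N) hs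
  have hCt : ENNReal.ofReal (fracLapConst N s / 2) * (2 * (∫⁻ z, k z)) ≠ ⊤ :=
    ENNReal.mul_ne_top ENNReal.ofReal_ne_top (ENNReal.mul_ne_top (by simp) hkt)
  refine ⟨(ENNReal.ofReal (fracLapConst N s / 2) * (2 * (∫⁻ z, k z))).toReal + 1, by positivity,
    fun w hw hw0 => ?_⟩
  set p : ℝ := (N : ℝ) + 2 * s with hp
  set B := Metric.ball (0 : EuclideanSpace ℝ (Fin N)) 1 with hBdef
  have hB : MeasurableSet B := Metric.isOpen_ball.measurableSet
  have hF : Measurable (fun x => ENNReal.ofReal (w x ^ 2)) := by fun_prop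
  have hK : Measurable (fun q : EuclideanSpace ℝ (Fin N) × EuclideanSpace ℝ (Fin N) =>
        ENNReal.ofReal ((w q.1 - w q.2) ^ 2 / ‖q.1 - q.2‖ ^ p)) := by fun_prop
  have hbase : ∫⁻ x, ∫⁻ y, (B ×ˢ B).indicator (fun q =>
      ENNReal.ofReal ((w q.1 - w q.2) ^ 2 / ‖q.1 - q.2‖ ^ p)) (x, y) =
      ∫⁻ x in B, ∫⁻ y in B, ENNReal.ofReal ((w x - w y) ^ 2 / ‖x - y‖ ^ p) := by
    rw [← lintegral_indicator hB]
    refine lintegral_congr fun x => ?_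
    by_cases hx : x ∈ B
    · rw [Set.indicator_of_mem hx, ← lintegral_indicator hB]
      refine lintegral_congr fun y => ?_
      by_cases hy : y ∈ B <;> simp [Set.indicator, hx, hy]
    · simp [Set.indicator, hx]
  have hwF : ∫⁻ x, ENNReal.ofReal (w x ^ 2) = ∫⁻ x in B, ENNReal.ofReal (w x ^ 2) := by
    rw [← lintegral_indicator hB]
    refine lintegral_congr fun x => ?_
    by_cases hx : x ∈ B
    · rw [Set.indicator_of_mem hx]
    · rw [Set.indicator_of_notMem hx, hw0]
      · simp
      · rw [hBdef, mem_ball_zero_iff, not_lt] at hx; linarith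
  have hfar : ∀ x y, ‖x‖ < 3 / 4 → y ∉ B →
      ENNReal.ofReal (w x ^ 2 / ‖x - y‖ ^ p) ≤ ENNReal.ofReal (w x ^ 2) * k (x - y) := by
    intro x y hx hy
    rw [hBdef, mem_ball_zero_iff, not_lt] at hy
    have h1 : 1 / 4 ≤ ‖x - y‖ := by
      have := norm_sub_norm_le y x
      rw [norm_sub_rev] at this
      linarith
    rw [div_eq_mul_one_div, ENNReal.ofReal_mul (sq_nonneg _)]
    gcongr
    exact hkz _ h1
  -- With exactly one point outside `B`, either the other value of `w` vanishes too or the points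
  -- are at least `1/4` apart.
  have hpt : ∀ x y, ENNReal.ofReal ((w x - w y) ^ 2 / ‖x - y‖ ^ p) ≤
      (B ×ˢ B).indicator (fun q =>
        ENNReal.ofReal ((w q.1 - w q.2) ^ 2 / ‖q.1 - q.2‖ ^ p)) (x, y) +
      (ENNReal.ofReal (w x ^ 2) + ENNReal.ofReal (w y ^ 2)) * k (x - y) := by
    intro x y
    have hout : ∀ z, z ∉ B → w z = 0 := fun z hz => hw0 z (by
      rw [hBdef, mem_ball_zero_iff, not_lt] at hz; linarith)
    by_cases hx : x ∈ B <;> by_cases hy : y ∈ B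
    · rw [Set.indicator_of_mem (Set.mk_mem_prod hx hy)]
      exact le_self_add
    · rw [Set.indicator_of_notMem (fun h => hy h.2), hout y hy, sub_zero, zero_add]
      rcases le_or_gt (3 / 4) ‖x‖ with h | h
      · simp [hw0 x h]
      · refine (hfar x y h hy).trans ?_
        gcongr
        exact le_self_add
    · rw [Set.indicator_of_notMem (fun h => hx h.1), hout x hx, zero_sub, zero_add, neg_sq]
      rcases le_or_gt (3 / 4) ‖y‖ with h | h
      · simp [hw0 y h]
      · rw [norm_sub_rev, ← hk' (x - y), neg_sub]
        refine (hfar y x h hx).trans ?_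
        gcongr
        exact le_add_self
    · simp [hout x hx, hout y hy]
  have hschur := lintegral_add_mul_kernel_le (μ := volume) hk hF hk' Set.univ
  rw [normLp_two_sq]
  simp only [Measure.restrict_univ, regionalForm, ← hp] at hschur ⊢
  calc _ ≤ ENNReal.ofReal (fracLapConst N s / 2) *
        ((∫⁻ x in B, ∫⁻ y in B, ENNReal.ofReal ((w x - w y) ^ 2 / ‖x - y‖ ^ p)) +
        ∫⁻ x, ∫⁻ y, (ENNReal.ofReal (w x ^ 2) + ENNReal.ofReal (w y ^ 2)) * k (x - y)) := by
        refine mul_le_mul_right ?_ _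
        have hKi := hK.indicator (hB.prod hB)
        rw [← hbase]
        refine le_trans (lintegral_mono fun x => lintegral_mono fun y => hpt x y)
          (le_of_eq (lintegral_lintegral_add_left (K := fun x y => (B ×ˢ B).indicator (fun q =>
            ENNReal.ofReal ((w q.1 - w q.2) ^ 2 / ‖q.1 - q.2‖ ^ p)) (x, y)) hKi _))
    _ ≤ _ := by
        rw [mul_add]
        refine add_le_add le_rfl ((mul_le_mul_right hschur _).trans ?_)
        rw [hwF, ← mul_assoc]
        refine mul_le_mul_left ?_ _
        rw [← ENNReal.ofReal_toReal hCt]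
        exact ENNReal.ofReal_le_ofReal (by simp)

end Localization

/-! ### Almost everywhere invariance, the Sobolev inequality, splitting of the `L^p` norm. -/

section Invariance

variable {N : ℕ} {s : ℝ} {Ω : Set (EuclideanSpace ℝ (Fin N))}
  {u v : EuclideanSpace ℝ (Fin N) → ℝ}

theorem regionalForm_congr_ae (h : u =ᵐ[volume.restrict Ω] v) :
    regionalForm N s Ω u = regionalForm N s Ω v := by
  rw [regionalForm, regionalForm]
  congr 1
  refine lintegral_congr_ae (h.mono fun x hx => lintegral_congr_ae (h.mono fun y hy => ?_))
  simp only [hx, hy]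

theorem normLp_congr_ae {p : ℝ} (h : u =ᵐ[volume.restrict Ω] v) :
    normLp N p Ω u = normLp N p Ω v :=
  eLpNorm_congr_ae h

theorem MemHs0.congr_ae (hu : MemHs0 N s Ω u) (h : u =ᵐ[volume.restrict Ω] v) :
    MemHs0 N s Ω v := by
  refine ⟨⟨hu.1.1.congr h, ?_⟩, fun ε hε => ?_⟩
  · have := hu.1.2
    rwa [normSqHs, normLp_congr_ae h, regionalForm_congr_ae h] at this
  · obtain ⟨φ, hφ, hlt⟩ := hu.2 ε hε
    have h' : (fun x => u x - φ x) =ᵐ[volume.restrict Ω] fun x => v x - φ x :=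
      h.mono fun x hx => by simp only [hx]
    refine ⟨φ, hφ, ?_⟩
    rwa [normSqHs, normLp_congr_ae h', regionalForm_congr_ae h'] at hlt

/-- The infimum runs over functions that are not almost everywhere zero, so the zero class is
treated apart. -/
theorem sobolevConst_mul_le (hu : MemHs0 N s Ω u) :
    sobolevConst N s Ω * normLp N (critExp N s) Ω u ^ 2 ≤ regionalForm N s Ω u := by
  by_cases h0 : ∀ᵐ x ∂volume.restrict Ω, u x = 0
  · have : normLp N (critExp N s) Ω u = 0 := by
      rw [normLp, eLpNorm_congr_ae (g := 0) h0, eLpNorm_zero]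
    simp [this]
  · refine ENNReal.mul_le_of_le_div ?_
    exact (iInf_le _ u).trans ((iInf_le _ hu).trans (iInf_le _ h0))

/-- The triangle inequality in `L^{p/2}` for the squares of `cos θ · u` and `sin θ · u`. -/
theorem normLp_sq_le_cos_add_sin {p : ℝ} (hp : 2 ≤ p) {θ : EuclideanSpace ℝ (Fin N) → ℝ}
    (hc : Measurable fun x => Real.cos (θ x) * u x)
    (hs : Measurable fun x => Real.sin (θ x) * u x) :
    normLp N p Ω u ^ 2 ≤ normLp N p Ω (fun x => Real.cos (θ x) * u x) ^ 2 +
      normLp N p Ω (fun x => Real.sin (θ x) * u x) ^ 2 := by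
  have hP : ENNReal.ofReal (p / 2) * ENNReal.ofReal 2 = ENNReal.ofReal p := by
    rw [← ENNReal.ofReal_mul (by linarith)]; congr 1; ring
  have hsq : ∀ f : EuclideanSpace ℝ (Fin N) → ℝ,
      normLp N p Ω f ^ 2 = eLpNorm (fun x => ‖f x‖ ^ (2 : ℝ)) (ENNReal.ofReal (p / 2))
        (volume.restrict Ω) := fun f => by
    rw [eLpNorm_norm_rpow f (by norm_num), hP, normLp, ← ENNReal.rpow_natCast]; norm_num
  rw [hsq, hsq, hsq]
  have hadd : (fun x => ‖u x‖ ^ (2 : ℝ)) = (fun x => ‖Real.cos (θ x) * u x‖ ^ (2 : ℝ)) +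
      fun x => ‖Real.sin (θ x) * u x‖ ^ (2 : ℝ) := by
    funext x
    simp only [Pi.add_apply, Real.rpow_two, Real.norm_eq_abs, sq_abs]
    linear_combination -(u x ^ 2) * Real.sin_sq_add_cos_sq (θ x)
  rw [hadd]
  refine eLpNorm_add_le ?_ ?_ ?_
  · exact (by fun_prop : Measurable _).aestronglyMeasurable
  · exact (by fun_prop : Measurable _).aestronglyMeasurable
  · rw [← ENNReal.ofReal_one]
    exact ENNReal.ofReal_le_ofReal (by linarith)

end Invariance

/-! ### The inner cutoff as a bounded map into `H^s_0(ℝ^N)`; finiteness of the Sobolev constant. -/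

section Cutoff

theorem normLp_two_sq_mul_le {N : ℕ} {Ω : Set (EuclideanSpace ℝ (Fin N))}
    {χ u : EuclideanSpace ℝ (Fin N) → ℝ} (hχ : ∀ x, |χ x| ≤ 1) :
    normLp N 2 Ω (fun x => χ x * u x) ^ 2 ≤ normLp N 2 Ω u ^ 2 := by
  rw [normLp_two_sq, normLp_two_sq]
  refine lintegral_mono fun x => ENNReal.ofReal_le_ofReal ?_
  have h := hχ x
  rw [mul_pow, ← sq_abs (χ x)]
  have : |χ x| ^ 2 ≤ 1 := pow_le_one₀ (abs_nonneg _) h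
  nlinarith [sq_nonneg (u x)]

variable {N : ℕ} {s : ℝ} {θ : ℝ → ℝ} {L : ℝ}

/-- Multiplication by the inner cutoff maps `H^s` of the ball to `H^s(ℝ^N)`. -/
theorem normSqHs_univ_cos_mul_le (hN : 2 ≤ N) (hs : 0 < s) (hs' : s < 1) (hθ : Continuous θ)
    (hL : ∀ x y : EuclideanSpace ℝ (Fin N), |θ ‖x‖ - θ ‖y‖| ≤ L * ‖x - y‖)
    (hθ1 : ∀ r, 3 / 4 ≤ r → θ r = Real.pi / 2) :
    ∃ C : ℝ, 0 < C ∧ ∀ u : EuclideanSpace ℝ (Fin N) → ℝ, Measurable u →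
      normSqHs N s Set.univ (fun x => Real.cos (θ ‖x‖) * u x) ≤
        ENNReal.ofReal C * normSqHs N s (Metric.ball 0 1) u := by
  obtain ⟨C₁, hC₁, h1⟩ := regionalForm_cos_add_sin_le hN hs' hθ hL
  obtain ⟨C₂, hC₂, h2⟩ := regionalForm_univ_le (N := N) hs
  refine ⟨1 + C₁ + C₂, by positivity, fun u hu => ?_⟩
  have hθm : Measurable θ := hθ.measurable
  have hcu : Measurable (fun x : EuclideanSpace ℝ (Fin N) => Real.cos (θ ‖x‖) * u x) := by fun_prop
  have hz : ∀ x : EuclideanSpace ℝ (Fin N), 3 / 4 ≤ ‖x‖ → Real.cos (θ ‖x‖) * u x = 0 :=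
    fun x hx => by rw [hθ1 _ hx, Real.cos_pi_div_two, zero_mul]
  have hB : MeasurableSet (Metric.ball (0 : EuclideanSpace ℝ (Fin N)) 1) :=
    Metric.isOpen_ball.measurableSet
  have hn : normLp N 2 Set.univ (fun x => Real.cos (θ ‖x‖) * u x) ^ 2 =
      normLp N 2 (Metric.ball 0 1) (fun x => Real.cos (θ ‖x‖) * u x) ^ 2 := by
    rw [normLp_two_sq, normLp_two_sq, Measure.restrict_univ, ← lintegral_indicator hB]
    refine lintegral_congr fun x => ?_
    by_cases hx : x ∈ Metric.ball (0 : EuclideanSpace ℝ (Fin N)) 1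
    · rw [Set.indicator_of_mem hx]
    · rw [Set.indicator_of_notMem hx, hz]
      · simp
      · rw [mem_ball_zero_iff, not_lt] at hx; linarith
  have hle : normLp N 2 (Metric.ball 0 1) (fun x => Real.cos (θ ‖x‖) * u x) ^ 2 ≤
      normLp N 2 (Metric.ball 0 1) u ^ 2 :=
    normLp_two_sq_mul_le fun x => Real.abs_cos_le_one _
  rw [normSqHs, normSqHs, hn]
  set n := normLp N 2 (Metric.ball 0 1) u ^ 2
  set Q := regionalForm N s (Metric.ball 0 1) u
  calc _ ≤ n + ((Q + ENNReal.ofReal C₁ * n) + ENNReal.ofReal C₂ * n) := by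
        refine add_le_add hle ((h2 _ hcu hz).trans (add_le_add (le_self_add.trans (h1 u hu)) ?_))
        gcongr
    _ = (1 + ENNReal.ofReal C₁ + ENNReal.ofReal C₂) * n + Q := by ring
    _ ≤ (1 + ENNReal.ofReal C₁ + ENNReal.ofReal C₂) * n +
          (1 + ENNReal.ofReal C₁ + ENNReal.ofReal C₂) * Q := by
        gcongr
        refine le_mul_of_one_le_left zero_le ?_
        rw [add_assoc]; exact le_self_add
    _ = _ := by
        rw [ENNReal.ofReal_add (by positivity) hC₂.le, ENNReal.ofReal_add (by positivity) hC₁.le,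
          ENNReal.ofReal_one]
        ring

theorem isTestFunction_cos_mul {φ : EuclideanSpace ℝ (Fin N) → ℝ}
    (hφ : ContDiff ℝ ((⊤ : ℕ∞) : WithTop ℕ∞) φ)
    (hθ : ContDiff ℝ ((⊤ : ℕ∞) : WithTop ℕ∞) (fun x : EuclideanSpace ℝ (Fin N) => θ ‖x‖))
    (hθ1 : ∀ r, 3 / 4 ≤ r → θ r = Real.pi / 2) :
    IsTestFunction N Set.univ (fun x => Real.cos (θ ‖x‖) * φ x) := by
  refine ⟨(Real.contDiff_cos.comp hθ).mul hφ, ?_, Set.subset_univ _⟩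
  refine HasCompactSupport.intro (isCompact_closedBall 0 (3 / 4)) fun x hx => ?_
  rw [mem_closedBall_zero_iff, not_le] at hx
  rw [hθ1 _ hx.le, Real.cos_pi_div_two, zero_mul]

/-- The cutoff is bounded from `H^s` of the ball to `H^s(ℝ^N)`, so it carries approximations to
approximations. The approximants need only be smooth, since the cutoff supplies compact support;
this also admits constant functions. -/
theorem memHs0_univ_cos_mul (hN : 2 ≤ N) (hs : 0 < s) (hs' : s < 1) (hθ : Continuous θ)
    (hL : ∀ x y : EuclideanSpace ℝ (Fin N), |θ ‖x‖ - θ ‖y‖| ≤ L * ‖x - y‖)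
    (hθd : ContDiff ℝ ((⊤ : ℕ∞) : WithTop ℕ∞) (fun x : EuclideanSpace ℝ (Fin N) => θ ‖x‖))
    (hθ1 : ∀ r, 3 / 4 ≤ r → θ r = Real.pi / 2)
    {u : EuclideanSpace ℝ (Fin N) → ℝ} (hu : Measurable u)
    (hfin : normSqHs N s (Metric.ball 0 1) u < ⊤)
    (happ : ∀ ε : ℝ≥0∞, 0 < ε → ∃ φ, ContDiff ℝ ((⊤ : ℕ∞) : WithTop ℕ∞) φ ∧
      normSqHs N s (Metric.ball 0 1) (fun x => u x - φ x) < ε) :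
    MemHs0 N s Set.univ (fun x => Real.cos (θ ‖x‖) * u x) := by
  obtain ⟨C, hC, hmain⟩ := normSqHs_univ_cos_mul_le hN hs hs' hθ hL hθ1
  have hθm : Measurable θ := hθ.measurable
  have hC0 : ENNReal.ofReal C ≠ 0 := by simpa using hC
  refine ⟨⟨(by fun_prop : Measurable _).aestronglyMeasurable,
    (hmain u hu).trans_lt (ENNReal.mul_lt_top ENNReal.ofReal_lt_top hfin)⟩, fun ε hε => ?_⟩
  obtain ⟨φ, hφ, hlt⟩ := happ (ε / ENNReal.ofReal C)
    (ENNReal.div_pos hε.ne' ENNReal.ofReal_ne_top)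
  refine ⟨_, isTestFunction_cos_mul hφ hθd hθ1, ?_⟩
  have hsub : (fun x : EuclideanSpace ℝ (Fin N) => Real.cos (θ ‖x‖) * u x -
      Real.cos (θ ‖x‖) * φ x) = fun x => Real.cos (θ ‖x‖) * (u x - φ x) := by
    funext x; ring
  rw [hsub]
  refine (hmain _ (hu.sub hφ.continuous.measurable)).trans_lt ?_
  rw [mul_comm]
  exact (ENNReal.lt_div_iff_mul_lt (Or.inl hC0) (Or.inl ENNReal.ofReal_ne_top)).1 hlt

/-- One competitor suffices: the cutoff of the constant `1`, which equals `1` on the half ball.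
Finiteness is what lets `S` be absorbed by a small `ε` on the outer part. -/
theorem sobolevConst_univ_lt_top (hN : 2 ≤ N) (hs : 0 < s) (hs' : s < 1) :
    sobolevConst N s (Set.univ : Set (EuclideanSpace ℝ (Fin N))) < ⊤ := by
  obtain ⟨θ, L, hθ, -, hL, hθd, hθ0, hθ1⟩ := exists_radial_angle N
  have hθm : Measurable θ := hθ.measurable
  have hn0 : normSqHs N s (Metric.ball 0 1) (fun _ : EuclideanSpace ℝ (Fin N) => 0) = 0 := by
    rw [normSqHs, normLp_two_sq, regionalForm]; simp
  have hfin : normSqHs N s (Metric.ball 0 1) (fun _ : EuclideanSpace ℝ (Fin N) => 1) < ⊤ := by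
    rw [normSqHs, normLp_two_sq, regionalForm]
    simp [measure_ball_lt_top]
  have hmem := memHs0_univ_cos_mul hN hs hs' hθ hL hθd hθ1 measurable_const hfin fun ε hε =>
    ⟨fun _ => 1, contDiff_const, by simpa [hn0] using hε⟩
  set χ : EuclideanSpace ℝ (Fin N) → ℝ := fun x => Real.cos (θ ‖x‖) * 1 with hχ
  have hχm : Measurable χ := by fun_prop
  have hne : ¬ ∀ᵐ x ∂(volume.restrict (Set.univ : Set (EuclideanSpace ℝ (Fin N)))), χ x = 0 := by
    intro h
    rw [Measure.restrict_univ, ae_iff] at h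
    have hsub : Metric.ball (0 : EuclideanSpace ℝ (Fin N)) (1 / 2) ⊆ {x | ¬ χ x = 0} := by
      intro x hx
      rw [mem_ball_zero_iff] at hx
      simp [hχ, hθ0 _ (norm_nonneg x) hx.le]
    exact (Metric.measure_ball_pos volume (0 : EuclideanSpace ℝ (Fin N))
      (by norm_num : (0 : ℝ) < 1 / 2)).ne' (measure_mono_null hsub h)
  have hcrit : 0 < critExp N s := by
    have : (2 : ℝ) ≤ N := by exact_mod_cast hN
    rw [critExp]
    exact div_pos (by linarith) (by linarith)
  have hnorm : normLp N (critExp N s) Set.univ χ ≠ 0 := by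
    intro h
    rw [normLp, eLpNorm_eq_zero_iff hχm.aestronglyMeasurable (by simpa using hcrit)] at h
    exact hne h
  refine lt_of_le_of_lt ((iInf_le _ χ).trans ((iInf_le _ hmem).trans (iInf_le _ hne))) ?_
  refine ENNReal.div_lt_top ?_ (pow_ne_zero 2 hnorm)
  exact (lt_of_le_of_lt le_add_self hmem.1.2).ne

end Cutoff

/-! ### Assembly of the inner and outer estimates. -/

theorem mainTheorem8 (N : ℕ) (hN : 2 ≤ N) (s : ℝ) (hs : 1 / 2 < s) (hs' : s < 1) :
    ∃ C : ℝ, 0 < C ∧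
      ∀ u : EuclideanSpace ℝ (Fin N) → ℝ, MemHs0Rad N s (Metric.ball 0 1) u →
        sobolevConst N s Set.univ * normLp N (critExp N s) (Metric.ball 0 1) u ^ 2 ≤
          regionalForm N s (Metric.ball 0 1) u +
            ENNReal.ofReal C * normLp N 2 (Metric.ball 0 1) u ^ 2 := by
  have : Nonempty (Fin N) := ⟨⟨0, by omega⟩⟩
  have hs0 : 0 < s := by linarith
  obtain ⟨θ, L, hθ, -, hL, hθd, hθ0, hθ1⟩ := exists_radial_angle N
  have hθm : Measurable θ := hθ.measurable
  obtain ⟨S, hS⟩ : ∃ S, S = sobolevConst N s (Set.univ : Set (EuclideanSpace ℝ (Fin N))) :=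
    ⟨_, rfl⟩
  have hSt : S ≠ ⊤ := by rw [hS]; exact (sobolevConst_univ_lt_top hN hs0 hs').ne
  -- A positive real majorant of `S`. With `ε = σ⁻¹` the outer estimate costs exactly one copy of
  -- the form of `w`, all that localization can afford.
  set σ : ℝ := S.toReal + 1 with hσ
  have hσ0 : 0 < σ := by positivity
  have hSσ : S ≤ ENNReal.ofReal σ := by
    rw [← ENNReal.ofReal_toReal hSt]; exact ENNReal.ofReal_le_ofReal (by linarith)
  obtain ⟨C₁, hC₁, h1⟩ := regionalForm_cos_add_sin_le hN hs' hθ hL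
  obtain ⟨C₂, hC₂, h2⟩ := regionalForm_univ_le (N := N) hs0
  obtain ⟨C₃, hC₃, h3⟩ := normLp_sq_le_of_radial hN hs hs' (critExp N s)
    (ε := σ⁻¹) (by positivity)
  have hcrit : 2 ≤ critExp N s := by
    have : (2 : ℝ) ≤ N := by exact_mod_cast hN
    rw [critExp, le_div_iff₀ (by linarith)]
    linarith
  refine ⟨C₁ + C₂ + σ * C₃, by positivity, fun u₀ hu₀ => ?_⟩
  obtain ⟨f, hf⟩ := hu₀.2
  obtain ⟨g, hg, hug⟩ := exists_measurable_profile volume hu₀.1.1.1 hf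
  -- From here `u` is exactly radial with a measurable profile; every quantity involved ignores null
  -- sets.
  rw [regionalForm_congr_ae hug, normLp_congr_ae hug, normLp_congr_ae hug, ← hS]
  have hmem := hu₀.1.congr_ae hug
  set u : EuclideanSpace ℝ (Fin N) → ℝ := fun x => g ‖x‖ with hu
  have hum : Measurable u := by fun_prop
  set v : EuclideanSpace ℝ (Fin N) → ℝ := fun x => Real.cos (θ ‖x‖) * u x with hv
  set w : EuclideanSpace ℝ (Fin N) → ℝ := fun x => Real.sin (θ ‖x‖) * u x with hw
  have hvm : Measurable v := by fun_prop
  have hwm : Measurable w := by fun_prop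
  have hv0 : ∀ x, 3 / 4 ≤ ‖x‖ → v x = 0 := fun x hx => by
    simp only [hv]; rw [hθ1 _ hx, Real.cos_pi_div_two, zero_mul]
  have hvmem : MemHs0 N s Set.univ v := by
    refine memHs0_univ_cos_mul hN hs0 hs' hθ hL hθd hθ1 hum hmem.1.2 fun ε hε => ?_
    obtain ⟨φ, hφ, hlt⟩ := hmem.2 ε hε
    exact ⟨φ, hφ.1, hlt⟩
  set B := Metric.ball (0 : EuclideanSpace ℝ (Fin N)) 1 with hB
  set n := normLp N 2 B u ^ 2 with hn
  have hvn : normLp N 2 B v ^ 2 ≤ n := normLp_two_sq_mul_le fun x => Real.abs_cos_le_one _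
  have hwn : normLp N 2 B w ^ 2 ≤ n := normLp_two_sq_mul_le fun x => Real.abs_sin_le_one _
  have hvpart : S * normLp N (critExp N s) B v ^ 2 ≤
      regionalForm N s B v + ENNReal.ofReal C₂ * n := by
    calc _ ≤ S * normLp N (critExp N s) Set.univ v ^ 2 := by
          gcongr
          exact eLpNorm_mono_measure _ (Measure.restrict_mono (Set.subset_univ _) le_rfl)
      _ ≤ regionalForm N s Set.univ v := by rw [hS]; exact sobolevConst_mul_le hvmem
      _ ≤ _ := (h2 v hvm hv0).trans (by gcongr)
  have hwpart : S * normLp N (critExp N s) B w ^ 2 ≤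
      regionalForm N s B w + ENNReal.ofReal (σ * C₃) * n := by
    have h4 := h3 (fun r => Real.sin (θ r) * g r) (by fun_prop) fun r hr0 hr1 => by
      simp only [hθ0 r hr0 hr1, Real.sin_zero, zero_mul]
    calc _ ≤ ENNReal.ofReal σ * (ENNReal.ofReal σ⁻¹ * regionalForm N s B w +
            ENNReal.ofReal C₃ * normLp N 2 B w ^ 2) := mul_le_mul' hSσ h4
      _ = regionalForm N s B w + ENNReal.ofReal (σ * C₃) * normLp N 2 B w ^ 2 := by
          rw [mul_add, ← mul_assoc, ← mul_assoc, ← ENNReal.ofReal_mul hσ0.le,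
            ← ENNReal.ofReal_mul hσ0.le, mul_inv_cancel₀ hσ0.ne', ENNReal.ofReal_one, one_mul]
      _ ≤ _ := by gcongr
  calc S * normLp N (critExp N s) B u ^ 2
      ≤ S * (normLp N (critExp N s) B v ^ 2 + normLp N (critExp N s) B w ^ 2) := by
        gcongr
        exact normLp_sq_le_cos_add_sin hcrit hvm hwm
    _ ≤ (regionalForm N s B v + ENNReal.ofReal C₂ * n) +
          (regionalForm N s B w + ENNReal.ofReal (σ * C₃) * n) := by
        rw [mul_add]
        exact add_le_add hvpart hwpart
    _ = (regionalForm N s B v + regionalForm N s B w) +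
          (ENNReal.ofReal C₂ * n + ENNReal.ofReal (σ * C₃) * n) := by ring
    _ ≤ (regionalForm N s B u + ENNReal.ofReal C₁ * n) +
          (ENNReal.ofReal C₂ * n + ENNReal.ofReal (σ * C₃) * n) := by
        exact add_le_add (h1 u hum) le_rfl
    _ = _ := by
        rw [ENNReal.ofReal_add (by positivity) (by positivity), ENNReal.ofReal_add hC₁.le hC₂.le]
        ring
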